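/- Let $\vartheta\in(0,\pi/2)$, and let $p_0=(\cos\vartheta,0)$, $p_1=(0,\sin\vartheta)$, $p_2=(-\cos\vartheta,0)$, $p_3=(0,-\sin\vartheta)$ be the vertices of the rhombus of side $1$ with angle $2\vartheta$ at $p_0$ and $p_2$, so that the diagonals $p_0p_2$ and $p_1p_3$ have lengths $2\cos\vartheta$ and $2\sin\vartheta$. The rhombic Vicsek fractal $K_\vartheta$ is the unique non-empty compact set with $K_\vartheta=\bigcup_{i}w_i(K_\vartheta)$, where $w_1,\dots,w_5$ are the homotheties of ratio $1/3$ centred at the centre of the rhombus and at its four vertices. Let $V_0=\{p_0,\dots,p_3\}$ (the essential fixed points), let $E_0$ be the set of ordered pairs $e=(e^+,e^-)$ of distinct elements of $V_0$, and put $\ell(e)=|e^+-e^-|$. For a word $\sigma$ of length $|\sigma|=n$ let $w_\sigma=w_{\sigma(1)}\circ\dots\circ w_{\sigma(n)}$. The discrete spectral triple on $K_\vartheta$ is given by $\mathcal H=\bigoplus_{\sigma}\ell^2(E_0)$ (sum over all finite words), $\pi(f)\delta_{\sigma,e}=f(w_\sigma(e^+))\,\delta_{\sigma,e}$, $|D|\delta_{\sigma,e}=3^{|\sigma|}\ell(e)^{-1}\delta_{\sigma,e}$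 and $D=F|D|$, where the self-adjoint unitary $F$ sends $\delta_{\sigma,(p,q)}$ to $\delta_{\sigma,(q,p)}$; $[D,f]$ stands for $D\pi(f)-\pi(f)D$. The Vicsek square is $K_{\pi/4}$, and $\varphi_\vartheta(x,y)=(\sqrt2\cos\vartheta\,x,\sqrt2\sin\vartheta\,y)$ is the affine map carrying its vertices to those of the rhombus. For symmetric positive conductances $c$ on $E_0$ put $\mathcal E[u]=\sum_{(p,q)\in E_0}c_{pq}|u(p)-u(q)|^2$ and $S_n(\mathcal E)[g]=\sum_{|\sigma|=n}\mathcal E[g\circ w_\sigma]$; $\mathcal E$ is an eigenform with eigenvalue $\rho>0$ if $\inf\{S_1(\mathcal E)[g]: g|_{V_0}=u\}=\rho\,\mathcal E[u]$ for all $u:V_0\to\mathbb R$, and its self-similar energy is $\mathcal E_\infty[g]=\lim_n\rho^{-n}S_n(\mathcal E)[g]\in[0,\infty]$. Set $$H(\vartheta)=\frac{2+\sqrt{1+\tan^2\vartheta}}{2+\sqrt{1+\cot^2\vartheta}} .$$ Then, for every $\vartheta\in(0,\pi/2)$, $\varphi_\vartheta(K_{\pi/4})=K_\vartheta$; the form $\widehat{\mathcal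 E}$ on the vertices of the Vicsek square with conductances $(1,1,1,1,H,H^{-1})$, $H=H(\vartheta)$ (namely $1$ on the sides, $H$ on the diagonal that $\varphi_\vartheta$ maps to the diagonal of length $2\cos\vartheta$, $H^{-1}$ on the other diagonal) is an eigenform with eigenvalue $1/3$; the limit defining $\widehat{\mathcal E}_\infty[g]$ exists in $[0,\infty]$ for every continuous $g$ on $K_{\pi/4}$; and there is a constant $c>0$ such that for every continuous $f$ on $K_\vartheta$ with $\widehat{\mathcal E}_\infty[f\circ\varphi_\vartheta]<\infty$ the operator $|[D,f]|^2|D|^{-s}$ is trace class for all $s>1$ and $$\operatorname{Res}_{s=1}\operatorname{tr}\big(|[D,f]|^2|D|^{-s}\big)=\lim_{s\to1^+}(s-1)\operatorname{tr}\big(|[D,f]|^2|D|^{-s}\big)=c\,\widehat{\mathcal E}_\infty[f\circ\varphi_\vartheta].$$ Moreover, for every $H>0$ there is exactly one $\vartheta\in(0,\pi/2)$ with $H(\vartheta)=H$. -/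

import Mathlib

open Filter Topology
open scoped ENNReal NNReal lp

noncomputable section

namespace RhombicVicsek

/-! ### The fractal -/

/-- The Euclidean plane. -/
abbrev Plane : Type := EuclideanSpace ℝ (Fin 2)

/-- Vertices of the rhombus of side `1` centred at the origin. The angle at `vertex ϑ 0` and at
`vertex ϑ 2` is `2ϑ`; the diagonal joining `0` and `2` has length `2 cos ϑ`, the one joining
`1` and `3` has length `2 sin ϑ`. -/
def vertex (ϑ : ℝ) : Fin 4 → Plane :=
  ![!₂[Real.cos ϑ, 0], !₂[0, Real.sin ϑ], !₂[-Real.cos ϑ, 0], !₂[0, -Real.sin ϑ]]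

/-- Fixed points of the five similarities: the centre (index `0`) and the four vertices. -/
def fixedPt (ϑ : ℝ) : Fin 5 → Plane :=
  ![0, vertex ϑ 0, vertex ϑ 1, vertex ϑ 2, vertex ϑ 3]

/-- The five similarities with ratio `1/3`. -/
def sim (ϑ : ℝ) (i : Fin 5) (x : Plane) : Plane :=
  fixedPt ϑ i + (1 / 3 : ℝ) • (x - fixedPt ϑ i)

/-- `K` is the self-similar fractal of the family `w`: a non-empty compact set with
`K = ⋃ i, w i (K)`. -/
def IsSelfSimilarFractal (w : Fin 5 → Plane → Plane) (K : Set Plane) : Prop :=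
  K.Nonempty ∧ IsCompact K ∧ K = ⋃ i, w i '' K

theorem sim_lipschitz (ϑ : ℝ) (i : Fin 5) : LipschitzWith (1 / 3 : ℝ≥0) (sim ϑ i) := by
  refine LipschitzWith.of_dist_le_mul fun x y => ?_
  have h : sim ϑ i x - sim ϑ i y = (1 / 3 : ℝ) • (x - y) := by
    simp only [sim]; module
  rw [dist_eq_norm, dist_eq_norm, h, norm_smul]
  simp

/-- The set map `K ↦ ⋃ i, w i (K)` on non-empty compact sets. -/
def hutchinson (ϑ : ℝ) (K : TopologicalSpace.NonemptyCompacts Plane) :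
    TopologicalSpace.NonemptyCompacts Plane where
  carrier := ⋃ i, sim ϑ i '' K
  isCompact' := isCompact_iUnion fun i => K.isCompact.image (sim_lipschitz ϑ i).continuous
  nonempty' := Set.nonempty_iUnion.2 ⟨0, K.nonempty.image _⟩

theorem hutchinson_contracting (ϑ : ℝ) : ContractingWith (1 / 3 : ℝ≥0) (hutchinson ϑ) := by
  refine ⟨by rw [← NNReal.coe_lt_coe]; norm_num, fun A B => ?_⟩
  change Metric.hausdorffEDist (⋃ i, sim ϑ i '' (A : Set Plane)) (⋃ i, sim ϑ i '' (B : Set Plane))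
    ≤ _ * Metric.hausdorffEDist (A : Set Plane) (B : Set Plane)
  refine Metric.hausdorffEDist_iUnion_le.trans (iSup_le fun i => ?_)
  have key : ∀ A B : TopologicalSpace.NonemptyCompacts Plane, ∀ x ∈ sim ϑ i '' (A : Set Plane),
      ∃ y ∈ sim ϑ i '' (B : Set Plane), edist x y ≤
        ((1 / 3 : ℝ≥0) : ℝ≥0∞) * Metric.hausdorffEDist (A : Set Plane) (B : Set Plane) := by
    rintro A B _ ⟨x, hx, rfl⟩
    obtain ⟨y, hy, hxy⟩ := B.isCompact.exists_infEDist_eq_edist B.nonempty x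
    refine ⟨_, ⟨y, hy, rfl⟩, (sim_lipschitz ϑ i x y).trans ?_⟩
    gcongr
    rw [← hxy]
    exact Metric.infEDist_le_hausdorffEDist_of_mem hx
  refine Metric.hausdorffEDist_le_of_mem_edist (key A B) ?_
  intro x hx
  rw [Metric.hausdorffEDist_comm]
  exact key B A x hx

theorem existsUnique_fractal (ϑ : ℝ) : ∃! K : Set Plane, IsSelfSimilarFractal (sim ϑ) K := by
  have : Nonempty (TopologicalSpace.NonemptyCompacts Plane) :=
    ⟨⟨⟨{0}, isCompact_singleton⟩, by simp⟩⟩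
  have hc := hutchinson_contracting ϑ
  let K := ContractingWith.fixedPoint (hutchinson ϑ) hc
  have hK : hutchinson ϑ K = K := hc.fixedPoint_isFixedPt
  refine ⟨K, ⟨K.nonempty, K.isCompact,
    (congrArg (fun S : TopologicalSpace.NonemptyCompacts Plane => (S : Set Plane)) hK).symm⟩, ?_⟩
  rintro L ⟨hn, hcp, hL⟩
  let L' : TopologicalSpace.NonemptyCompacts Plane := ⟨⟨L, hcp⟩, hn⟩
  have hfix : Function.IsFixedPt (hutchinson ϑ) L' := SetLike.coe_injective hL.symm
  exact congrArg (fun S : TopologicalSpace.NonemptyCompacts Plane => (S : Set Plane))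
    (hc.fixedPoint_unique hfix)

/-- The rhombic Vicsek fractal with angle `2ϑ`. -/
def fractal (ϑ : ℝ) : Set Plane := (existsUnique_fractal ϑ).choose

theorem fractal_spec (ϑ : ℝ) : IsSelfSimilarFractal (sim ϑ) (fractal ϑ) :=
  (existsUnique_fractal ϑ).choose_spec.1

/-- The essential fixed points of the family of similarities. -/
def essentialFixedPoints (ϑ : ℝ) : Set Plane :=
  {x | ∃ i, x = fixedPt ϑ i ∧
    ∃ i' j j', i' ≠ i ∧ sim ϑ j (fixedPt ϑ i) = sim ϑ j' (fixedPt ϑ i')}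

/-- The set `V₀` of essential fixed points consists of the four vertices, so that it may be indexed
by `Fin 4` through `vertex`. -/
theorem essentialFixedPoints_eq {ϑ : ℝ} (h : ϑ ∈ Set.Ioo 0 (Real.pi / 2)) :
    essentialFixedPoints ϑ = Set.range (vertex ϑ) := by
  have hs : 0 < Real.sin ϑ := Real.sin_pos_of_pos_of_lt_pi h.1 (by linarith [h.2, Real.pi_pos])
  have hc : 0 < Real.cos ϑ := Real.cos_pos_of_mem_Ioo ⟨by linarith [h.1, Real.pi_pos], h.2⟩
  ext x
  constructor
  · rintro ⟨i, rfl, i', j, j', hne, he⟩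
    refine Fin.cases (motive := fun i => i' ≠ i → sim ϑ j (fixedPt ϑ i) = sim ϑ j' (fixedPt ϑ i') →
      fixedPt ϑ i ∈ Set.range (vertex ϑ)) ?_ (fun k _ _ => ⟨k, by fin_cases k <;> rfl⟩) i hne he
    intro hne he
    exfalso
    have h0 := congrArg (fun p : Plane => p 0) he
    have h1 := congrArg (fun p : Plane => p 1) he
    fin_cases i' <;> fin_cases j <;> fin_cases j' <;>
      simp [sim, fixedPt, vertex] at hne h0 h1 <;> linarith
  · rintro ⟨k, rfl⟩
    refine ⟨k.succ, by fin_cases k <;> rfl, (k + 2).succ, 0, k.succ, ?_, ?_⟩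
    · fin_cases k <;> decide
    · ext l
      fin_cases k <;> fin_cases l <;> simp [sim, fixedPt, vertex] <;> ring

/-- Words of length `n` in the five symbols. -/
abbrev Word (n : ℕ) : Type := Fin n → Fin 5

/-- `w_σ = w_{σ(1)} ∘ ⋯ ∘ w_{σ(n)}`. -/
def wordMap (ϑ : ℝ) : (n : ℕ) → Word n → Plane → Plane
  | 0, _ => id
  | n + 1, σ => sim ϑ (σ 0) ∘ wordMap ϑ n (Fin.tail σ)

/-- `E₀`: ordered pairs of distinct vertices. -/
abbrev Edge₀ : Type := {e : Fin 4 × Fin 4 // e.1 ≠ e.2}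

/-- The affine map carrying the square (`ϑ = π/4`) to the rhombus. -/
def deform (ϑ : ℝ) (x : Plane) : Plane :=
  !₂[√2 * Real.cos ϑ * x 0, √2 * Real.sin ϑ * x 1]

/-! ### Quadratic forms on `V₀`, eigenforms and self-similar energies -/

/-- `𝓔[u] = ∑_{(p,q) ∈ E₀} c_{pq} |u(p) - u(q)|²`, for real or complex functions on `V₀`. -/
def form {𝕜 : Type} [RCLike 𝕜] (c : Fin 4 → Fin 4 → ℝ) (u : Fin 4 → 𝕜) : ℝ :=
  ∑ e : Edge₀, c e.1.1 e.1.2 * ‖u e.1.1 - u e.1.2‖ ^ 2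

/-- `S_n(𝓔)[f] = ∑_{|σ| = n} 𝓔[f ∘ w_σ]`. Only the values of `f` on `V_n` matter. -/
def formSum {𝕜 : Type} [RCLike 𝕜] (ϑ : ℝ) (c : Fin 4 → Fin 4 → ℝ) (n : ℕ) (f : Plane → 𝕜) : ℝ :=
  ∑ σ : Word n, form c fun i => f (wordMap ϑ n σ (vertex ϑ i))

/-- The form with conductances `c` is an eigenform with eigenvalue `ρ`: `c` is symmetric and
positive, `ρ > 0`, and for every `u ∈ C(V₀)` the infimum of `S₁(𝓔)[g]` over the extensions `g`
of `u` is `ρ 𝓔[u]`. -/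
def IsEigenform (ϑ : ℝ) (c : Fin 4 → Fin 4 → ℝ) (ρ : ℝ) : Prop :=
  (∀ i j, i ≠ j → c i j = c j i ∧ 0 < c i j) ∧ 0 < ρ ∧
    ∀ u : Fin 4 → ℝ,
      IsGLB {t | ∃ g : Plane → ℝ, (∀ i, g (vertex ϑ i) = u i) ∧ t = formSum ϑ c 1 g}
        (ρ * form c u)

/-- `𝓔_∞[f] = lim_n ρ^{-n} S_n(𝓔)[f] ∈ [0, ∞]` (written as an upper limit, so as to be defined
for all `f`). -/
def limitEnergy (ϑ : ℝ) (c : Fin 4 → Fin 4 → ℝ) (ρ : ℝ) (f : Plane → ℂ) : ℝ≥0∞ :=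
  limsup (fun n : ℕ => ENNReal.ofReal ((ρ ^ n)⁻¹ * formSum ϑ c n f)) atTop

/-- Conductances `(1, 1, 1, 1, H, H⁻¹)`: `1` on the sides, `H` on the diagonal joining `0` and `2`,
`H⁻¹` on the diagonal joining `1` and `3`. The values for `i = j` play no role. -/
def vicsekConductance (H : ℝ) : Fin 4 → Fin 4 → ℝ :=
  !![0, 1, H, 1;
     1, 0, 1, H⁻¹;
     H, 1, 0, 1;
     1, H⁻¹, 1, 0]

/-- The parameter `H` attached to the angle. -/
def paramH (ϑ : ℝ) : ℝ :=
  (2 + √(1 + Real.tan ϑ ^ 2)) / (2 + √(1 + Real.cot ϑ ^ 2))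

/-! ### Unbounded operators -/

/-- Product of unbounded operators on its natural domain `{x ∈ dom S | S x ∈ dom T}`. -/
def opComp {H : Type} [AddCommGroup H] [Module ℂ H] (T S : H →ₗ.[ℂ] H) : H →ₗ.[ℂ] H :=
  T.comp (S.domRestrict ((T.domain.comap S.toFun).map S.domain.subtype)) (by
    rintro ⟨x, ⟨⟨y, hy⟩, hyT, rfl⟩, hx⟩
    exact hyT)

/-- `|T|² = T*T`, computed with the closure of `T`. -/
def absSq {H : Type} [NormedAddCommGroup H] [InnerProductSpace ℂ H] [CompleteSpace H]
    (T : H →ₗ.[ℂ] H) : H →ₗ.[ℂ] H :=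
  opComp T.closure.adjoint T.closure

/-- `A` is an everywhere defined bounded positive trace class operator with trace `t`. -/
def HasTrace {H : Type} [NormedAddCommGroup H] [InnerProductSpace ℂ H] [CompleteSpace H]
    (A : H →ₗ.[ℂ] H) (t : ℝ) : Prop :=
  ∃ B : H →L[ℂ] H, B.IsPositive ∧ A = (B : H →ₗ[ℂ] H).toPMap ⊤ ∧
    ∀ (ι : Type) (b : HilbertBasis ι ℂ H),
      HasSum (fun i => inner ℂ (b i) (B (b i))) (t : ℂ)

/-- Multiplication by `a` on `ℓ²(ι)`, on its maximal domain. -/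
def diagOp {ι : Type} (a : ι → ℂ) : ℓ²(ι, ℂ) →ₗ.[ℂ] ℓ²(ι, ℂ) where
  domain :=
    { carrier := {ξ | Memℓp (fun i => a i * ξ i) 2}
      add_mem' := fun {ξ η} hξ hη => by
        have h := Memℓp.add hξ hη
        refine (congrArg (fun g : ι → ℂ => Memℓp g 2) ?_).mp h
        funext i
        simp [mul_add]
      zero_mem' := by
        have h : (fun i => a i * (0 : ℓ²(ι, ℂ)) i) = 0 := by
          funext i
          simp
        change Memℓp (fun i => a i * (0 : ℓ²(ι, ℂ)) i) 2
        rw [h]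
        exact zero_memℓp
      smul_mem' := fun k ξ hξ => by
        have h := Memℓp.const_smul (𝕜 := ℂ) hξ k
        refine (congrArg (fun g : ι → ℂ => Memℓp g 2) ?_).mp h
        funext i
        simp [mul_left_comm] }
  toFun :=
    { toFun := fun ξ => ⟨fun i => a i * ξ.1 i, ξ.2⟩
      map_add' := fun ξ η => by
        ext i
        exact mul_add _ _ _
      map_smul' := fun k ξ => by
        ext i
        exact mul_left_comm _ _ _ }

/-! ### The discrete spectral triple -/

/-- Orthonormal basis of the Hilbert space `⨁_σ ⨁_{e ∈ E₀} ℓ²(e)`: pairs of a word `σ` and an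
oriented edge `e ∈ E₀`. -/
abbrev Edge : Type := (Σ n : ℕ, Word n) × Edge₀

/-- The Hilbert space of the triple. -/
abbrev Hilb : Type := ℓ²(Edge, ℂ)

/-- `w_σ(e⁺)`. -/
def Edge.src (ϑ : ℝ) (e : Edge) : Plane := wordMap ϑ e.1.1 e.1.2 (vertex ϑ e.2.1.1)

/-- The length of the edge `w_σ(e)`, equal to `3^{-|σ|} ℓ(e)`. -/
def Edge.length (ϑ : ℝ) (e : Edge) : ℝ :=
  (1 / 3 : ℝ) ^ e.1.1 * dist (vertex ϑ e.2.1.1) (vertex ϑ e.2.1.2)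

/-- The same edge with the opposite orientation. -/
def Edge.rev (e : Edge) : Edge := (e.1, ⟨(e.2.1.2, e.2.1.1), e.2.2.symm⟩)

theorem Edge.rev_injective : Function.Injective Edge.rev :=
  Function.LeftInverse.injective (g := Edge.rev) fun _ => rfl

/-- The unitary `F` sending each oriented edge to the opposite one. -/
def edgeFlip : Hilb →ₗ[ℂ] Hilb where
  toFun ξ := ⟨fun e => ξ e.rev, by
    have h := (memℓp_gen_iff (p := 2) (by norm_num)).1 (lp.memℓp ξ)
    exact (memℓp_gen_iff (p := 2) (by norm_num)).2 (h.comp_injective Edge.rev_injective)⟩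
  map_add' _ _ := rfl
  map_smul' _ _ := rfl

/-- `|D|`, the diagonal operator with entries `ℓ(e)⁻¹`. -/
def absDirac (ϑ : ℝ) : Hilb →ₗ.[ℂ] Hilb := diagOp fun e => ((e.length ϑ)⁻¹ : ℝ)

/-- `|D|^{-s}`. -/
def absDiracPow (ϑ s : ℝ) : Hilb →ₗ.[ℂ] Hilb := diagOp fun e => (((e.length ϑ)⁻¹ ^ (-s) : ℝ) : ℂ)

/-- The Dirac operator `D = F |D|`. -/
def dirac (ϑ : ℝ) : Hilb →ₗ.[ℂ] Hilb := edgeFlip.compPMap (absDirac ϑ)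

/-- The action `π(f)` of functions: multiplication by `f(w_σ(e⁺))`. -/
def rep (ϑ : ℝ) (f : Plane → ℂ) : Hilb →ₗ.[ℂ] Hilb := diagOp fun e => f (e.src ϑ)

/-- The commutator `[D, f] = D π(f) - π(f) D`. -/
def diracCommutator (ϑ : ℝ) (f : Plane → ℂ) : Hilb →ₗ.[ℂ] Hilb :=
  opComp (dirac ϑ) (rep ϑ f) - opComp (rep ϑ f) (dirac ϑ)

/-- The operator `|[D,f]|² |D|^{-s}`. -/
def zetaOperator (ϑ : ℝ) (f : Plane → ℂ) (s : ℝ) : Hilb →ₗ.[ℂ] Hilb :=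
  opComp (absSq (diracCommutator ϑ f)) (absDiracPow ϑ s)

end RhombicVicsek

end

/-! The commutator acts on the edge basis as a weighted permutation: it exchanges the two
orientations of an edge, with the difference quotient of $f$ as weight. Hence $|[D,f]|^2|D|^{-s}$ is
diagonal, and its trace is a sum over edges. Grouped by level $n$, this sum is, up to factors
$\ell(e)^{s-1}\to1$, the series $\sum_n 3^{-n(s-1)}\tau_n$ with $\tau_n=3^nS_n(\mathcal E_\ell)[f]$,
where $\mathcal E_\ell$ has conductances $\ell(e)^{-1}$. If $\tau_n\to l$, an Abelian theorem gives
the residue $l/\log 3$ (`exists_zeta`).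

The form $\mathcal E_\ell$ is not the eigenform. However, with unit sides every form is a
combination of the squared defect $|u_0+u_2-u_1-u_3|^2$ and the two squared diagonal differences
(`form_eq_of_unit_sides`). The value $H(\vartheta)$ is the one for which $\mathcal E_\ell$ equals
$\kappa\widehat{\mathcal E}$ plus a multiple of the defect (`form_lengthConductance`). A
sum-of-squares identity for one subdivision (`form_vicsek_sub_real`) shows that the renormalized
energies increase, and that their increments control the defects. For finite energy the defect terms
are therefore summable and disappear in the limit (`tendsto_scaledSum_defect`), so that
$l=\kappa\,\widehat{\mathcal E}_\infty$. -/

noncomputable section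

namespace RhombicVicsek

/-! ### Graphs of unbounded operators -/

section Graphs

variable {H : Type} [AddCommGroup H] [Module ℂ H]

/-- Working with graphs keeps domain conditions out of the later computations: a product of
operators becomes a composition of relations. -/
theorem mem_graph_opComp {T S : H →ₗ.[ℂ] H} {x y z : H} (hS : (x, y) ∈ S.graph)
    (hT : (y, z) ∈ T.graph) : (x, z) ∈ (opComp T S).graph := by
  rw [LinearPMap.mem_graph_iff] at hS hT ⊢
  obtain ⟨x', rfl, rfl⟩ := hS
  obtain ⟨y', hy, rfl⟩ := hT
  refine ⟨⟨x', ⟨⟨x', ?_, rfl⟩, x'.2⟩⟩, rfl, ?_⟩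
  · change S x' ∈ T.domain
    exact (show (y' : H) = S x' from hy) ▸ y'.2
  · change T ⟨S x', _⟩ = T y'
    congr 1
    exact Subtype.ext hy.symm

theorem exists_of_mem_graph_opComp {T S : H →ₗ.[ℂ] H} {x z : H}
    (h : (x, z) ∈ (opComp T S).graph) : ∃ y, (x, y) ∈ S.graph ∧ (y, z) ∈ T.graph := by
  rw [LinearPMap.mem_graph_iff] at h
  obtain ⟨⟨x', hx1, hx2⟩, rfl, rfl⟩ := h
  obtain ⟨⟨y, hy⟩, hyT, rfl⟩ := hx1
  refine ⟨S ⟨y, hy⟩, LinearPMap.mem_graph S ⟨y, hy⟩, ?_⟩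
  exact LinearPMap.mem_graph T ⟨S ⟨y, hy⟩, hyT⟩

theorem mem_graph_sub {T S : H →ₗ.[ℂ] H} {x y z : H} (hT : (x, y) ∈ T.graph)
    (hS : (x, z) ∈ S.graph) : (x, y - z) ∈ (T - S).graph := by
  rw [LinearPMap.mem_graph_iff] at hS hT ⊢
  obtain ⟨x', rfl, rfl⟩ := hT
  obtain ⟨y', hy, rfl⟩ := hS
  refine ⟨⟨x', x'.2, (show (y' : H) = x' from hy) ▸ y'.2⟩, rfl, ?_⟩
  rw [LinearPMap.sub_apply]
  congr 2
  exact Subtype.ext hy.symm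

theorem exists_of_mem_graph_sub {T S : H →ₗ.[ℂ] H} {x w : H} (h : (x, w) ∈ (T - S).graph) :
    ∃ y z, (x, y) ∈ T.graph ∧ (x, z) ∈ S.graph ∧ w = y - z := by
  rw [LinearPMap.mem_graph_iff] at h
  obtain ⟨⟨x', hx1, hx2⟩, rfl, rfl⟩ := h
  exact ⟨T ⟨x', hx1⟩, S ⟨x', hx2⟩, T.mem_graph ⟨x', hx1⟩, S.mem_graph ⟨x', hx2⟩, rfl⟩

theorem eq_toPMap_top_of_mem_graph {A : H →ₗ.[ℂ] H} {B : H →ₗ[ℂ] H}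
    (h : ∀ x, (x, B x) ∈ A.graph) : A = B.toPMap ⊤ := by
  refine (LinearPMap.eq_of_le_of_domain_eq (f := B.toPMap ⊤) (g := A) ?_ ?_).symm
  · refine LinearPMap.le_of_le_graph ?_
    rintro ⟨x, y⟩ hxy
    obtain ⟨x', rfl, rfl⟩ := (LinearPMap.mem_graph_iff _).1 hxy
    exact h _
  · ext x
    refine ⟨fun _ => LinearPMap.mem_domain_iff.2 ⟨_, h x⟩, fun _ => ?_⟩
    simp

end Graphs

theorem mem_graph_adjoint {H : Type} [NormedAddCommGroup H] [InnerProductSpace ℂ H]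
    [CompleteSpace H] {T : H →ₗ.[ℂ] H} (hT : Dense (T.domain : Set H)) {y x : H}
    (h : ∀ u v, (u, v) ∈ T.graph → inner ℂ x u = inner ℂ y v) : (y, x) ∈ T.adjoint.graph := by
  have h' : ∀ u : T.domain, inner ℂ x (u : H) = inner ℂ y (T u) := fun u => h _ _ (T.mem_graph u)
  have hy : y ∈ T.adjoint.domain := LinearPMap.mem_adjoint_domain_of_exists y ⟨x, h'⟩
  rw [LinearPMap.mem_graph_iff]
  exact ⟨⟨y, hy⟩, rfl, LinearPMap.adjoint_apply_eq hT ⟨y, hy⟩ h'⟩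

/-! ### Diagonal and weighted permutation operators on `ℓ²`. -/

section Diagonal

variable {ι : Type}

theorem mem_graph_diagOp {a : ι → ℂ} {x y : ℓ²(ι, ℂ)} :
    (x, y) ∈ (diagOp a).graph ↔ ∀ i, y i = a i * x i := by
  rw [LinearPMap.mem_graph_iff]
  constructor
  · rintro ⟨x', rfl, rfl⟩ i
    rfl
  · intro h
    have hx : x ∈ (diagOp a).domain := by
      change Memℓp (fun i => a i * x i) 2
      rw [← funext h]
      exact lp.memℓp y
    exact ⟨⟨x, hx⟩, rfl, lp.ext (funext fun i => (h i).symm)⟩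

theorem memℓp_two_iff {x : ι → ℂ} : Memℓp x 2 ↔ Summable fun i => ‖x i‖ ^ 2 := by
  rw [memℓp_gen_iff (by norm_num)]
  simp

theorem summable_norm_sq (x : ℓ²(ι, ℂ)) : Summable fun i => ‖x i‖ ^ 2 :=
  memℓp_two_iff.1 (lp.memℓp x)

theorem memℓp_two_mul {a : ι → ℂ} {C : ℝ} (ha : ∀ i, ‖a i‖ ≤ C) (x : ℓ²(ι, ℂ)) :
    Memℓp (fun i => a i * x i) 2 := by
  refine memℓp_two_iff.2 (((summable_norm_sq x).mul_left (C ^ 2)).of_nonneg_of_le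
    (fun i => by positivity) fun i => ?_)
  rw [norm_mul, mul_pow]
  gcongr
  exact ha i

/-- The bounded operator of multiplication by a bounded family. -/
def diagCLM (a : ι → ℂ) (C : ℝ) (ha : ∀ i, ‖a i‖ ≤ C) : ℓ²(ι, ℂ) →L[ℂ] ℓ²(ι, ℂ) :=
  LinearMap.mkContinuous
    { toFun := fun x => ⟨fun i => a i * x i, memℓp_two_mul ha x⟩
      map_add' := fun x y => by ext i; exact mul_add _ _ _
      map_smul' := fun k x => by ext i; exact mul_left_comm _ _ _ } |C| (fun x => by
    have h2 : (0 : ℝ) < (2 : ℝ≥0∞).toReal := by norm_num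
    refine lp.norm_le_of_forall_sum_le h2 (by positivity) fun s => ?_
    rw [Real.mul_rpow (by positivity) (by positivity)]
    refine le_trans ?_ (mul_le_mul_of_nonneg_left (lp.sum_rpow_le_norm_rpow h2 x s)
      (by positivity))
    rw [Finset.mul_sum]
    refine Finset.sum_le_sum fun i _ => ?_
    rw [← Real.mul_rpow (by positivity) (by positivity)]
    refine Real.rpow_le_rpow (by positivity) ?_ (by positivity)
    change ‖a i * x i‖ ≤ _
    rw [norm_mul]
    gcongr
    exact (ha i).trans (le_abs_self C))

theorem diagCLM_apply (a : ι → ℂ) (C : ℝ) (ha : ∀ i, ‖a i‖ ≤ C) (x : ℓ²(ι, ℂ)) (i : ι) :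
    diagCLM a C ha x i = a i * x i := rfl

theorem isPositive_diagCLM (a : ι → ℝ) (C : ℝ) (ha : ∀ i, ‖(a i : ℂ)‖ ≤ C)
    (h0 : ∀ i, 0 ≤ a i) : (diagCLM (fun i => (a i : ℂ)) C ha).IsPositive := by
  refine ⟨fun x y => ?_, fun x => ?_⟩
  · change inner ℂ (diagCLM _ C ha x) y = inner ℂ x (diagCLM _ C ha y)
    rw [lp.inner_eq_tsum, lp.inner_eq_tsum]
    refine tsum_congr fun i => ?_
    simp only [diagCLM_apply, RCLike.inner_apply, map_mul, Complex.conj_ofReal]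
    ring
  · rw [ContinuousLinearMap.reApplyInnerSelf_apply]
    have h := (lp.hasSum_inner (diagCLM (fun i => (a i : ℂ)) C ha x) x).mapL Complex.reCLM
    refine h.nonneg fun i => ?_
    simp only [diagCLM_apply, RCLike.inner_apply, map_mul, Complex.conj_ofReal,
      Complex.reCLM_apply]
    have : x i * ((a i : ℂ) * (starRingEnd ℂ) (x i)) = ((a i * ‖x i‖ ^ 2 : ℝ) : ℂ) := by
      rw [mul_left_comm, Complex.mul_conj']; push_cast; ring
    rw [this, Complex.ofReal_re]
    exact mul_nonneg (h0 i) (by positivity)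

/-- The trace of a positive summable diagonal operator may be computed in any basis. -/
theorem hasSum_inner_diagCLM (a : ι → ℝ) (C : ℝ) (ha : ∀ i, ‖(a i : ℂ)‖ ≤ C)
    (h0 : ∀ i, 0 ≤ a i) (hs : Summable a) {κ : Type} (b : HilbertBasis κ ℂ ℓ²(ι, ℂ)) :
    HasSum (fun k => inner ℂ (b k) (diagCLM (fun i => (a i : ℂ)) C ha (b k)))
      ((∑' i, a i : ℝ) : ℂ) := by
  classical
  -- Parseval for the unit vector at `i`: its squared coefficients in the basis `b` sum to `1`. The
  -- trace formula is then Tonelli for a nonnegative double family.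
  have hcol : ∀ i, HasSum (fun k => a i * ‖b k i‖ ^ 2) (a i) := fun i => by
    have h := (b.hasSum_inner_mul_inner (lp.single 2 i (1 : ℂ)) (lp.single 2 i (1 : ℂ))).mapL
      Complex.reCLM
    have h1 : ∀ k, Complex.reCLM (inner ℂ (lp.single 2 i (1 : ℂ)) (b k) *
        inner ℂ (b k) (lp.single 2 i (1 : ℂ))) = ‖b k i‖ ^ 2 := fun k => by
      rw [lp.inner_single_left, lp.inner_single_right]
      simp only [RCLike.inner_apply, map_one, mul_one, one_mul, Complex.reCLM_apply]
      rw [Complex.mul_conj', ← Complex.ofReal_pow, Complex.ofReal_re]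
    simp only [h1] at h
    have h2 : Complex.reCLM (inner ℂ (lp.single 2 i (1 : ℂ) : ℓ²(ι, ℂ))
        (lp.single 2 i (1 : ℂ))) = 1 := by
      rw [lp.inner_single_left]; simp
    rw [h2] at h
    simpa using h.mul_left (a i)
  have hsum : Summable fun p : ι × κ => a p.1 * ‖b p.2 p.1‖ ^ 2 := by
    rw [summable_prod_of_nonneg fun p => mul_nonneg (h0 _) (by positivity)]
    refine ⟨fun i => (hcol i).summable, ?_⟩
    simpa only [(hcol _).tsum_eq] using hs
  have htot : HasSum (fun p : ι × κ => a p.1 * ‖b p.2 p.1‖ ^ 2) (∑' i, a i) := by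
    rw [hsum.hasSum_iff, hsum.tsum_prod]
    exact tsum_congr fun i => (hcol i).tsum_eq
  have hrow : ∀ k, HasSum (fun i => ((a i * ‖b k i‖ ^ 2 : ℝ) : ℂ))
      (inner ℂ (b k) (diagCLM (fun i => (a i : ℂ)) C ha (b k))) := fun k => by
    have h := lp.hasSum_inner (𝕜 := ℂ) (b k) (diagCLM (fun i => (a i : ℂ)) C ha (b k))
    refine (congrArg (HasSum · _) (funext fun i => ?_)).mpr h
    simp only [diagCLM_apply, RCLike.inner_apply]
    rw [mul_assoc, Complex.mul_conj']
    push_cast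
    ring
  have hswap := (Equiv.prodComm κ ι).hasSum_iff.2 (Complex.hasSum_ofReal.2 htot)
  exact hswap.prod_fiberwise hrow

/-- A weighted permutation operator defined on the unit vectors has, as its closure, the same
operator on its maximal domain. -/
theorem mem_graph_closure_iff {r : ι → ι} (hr : Function.Involutive r) {d : ι → ℂ}
    {T : ℓ²(ι, ℂ) →ₗ.[ℂ] ℓ²(ι, ℂ)}
    (hT : ∀ x y, (x, y) ∈ T.graph → ∀ i, y i = d i * x (r i))
    (hdom : ∀ [DecidableEq ι] (i : ι) (k : ℂ), lp.single 2 i k ∈ T.domain) {x y : ℓ²(ι, ℂ)} :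
    (x, y) ∈ T.closure.graph ↔ ∀ i, y i = d i * x (r i) := by
  classical
  have hev : ∀ i, Continuous fun x : ℓ²(ι, ℂ) => x i := fun i =>
    (lp.lipschitzWith_one_eval (E := fun _ : ι => ℂ) 2 i).continuous
  have hcl : ∀ x y, (x, y) ∈ T.graph.topologicalClosure → ∀ i, y i = d i * x (r i) := by
    intro x y hxy i
    have hc : IsClosed {p : ℓ²(ι, ℂ) × ℓ²(ι, ℂ) | p.2 i = d i * p.1 (r i)} :=
      isClosed_eq ((hev i).comp continuous_snd)
        (continuous_const.mul ((hev (r i)).comp continuous_fst))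
    exact closure_minimal (s := (T.graph : Set _)) (fun p hp => hT p.1 p.2 hp i) hc hxy
  -- The coordinate relation survives closure, so a pair $(0,v)$ in the closed graph has $v=0$.
  have hclosable : T.IsClosable := by
    refine ⟨T.graph.topologicalClosure.toLinearPMap, (Submodule.toLinearPMap_graph_eq _ ?_).symm⟩
    rintro ⟨u, v⟩ huv (rfl : u = 0)
    refine lp.ext (funext fun i => ?_)
    simpa using hcl _ _ huv i
  rw [← hclosable.graph_closure_eq_closure_graph]
  refine ⟨hcl x y, fun h => ?_⟩
  have hsingle : ∀ i, (lp.single 2 i (x i), lp.single 2 (r i) (y (r i))) ∈ T.graph := fun i => by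
    have hm := T.mem_graph ⟨_, hdom i (x i)⟩
    have he : T ⟨_, hdom i (x i)⟩ = lp.single 2 (r i) (y (r i)) := by
      refine lp.ext (funext fun j => ?_)
      rw [hT _ _ hm j]
      by_cases hj : j = r i
      · subst hj
        simp [h (r i), hr i]
      · have hj' : r j ≠ i := fun hji => hj (by rw [← hji, hr j])
        rw [lp.single_apply_ne _ _ _ hj, lp.single_apply_ne _ _ _ hj', mul_zero]
    rw [he] at hm
    exact hm
  -- Both vectors are limits of finite sums of unit vectors. The expansion of `y` is reindexed by
  -- `r` so that partial sums over the same finite set form a pair in the graph.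
  have hx := lp.hasSum_single (by norm_num) x
  have hy := (hr.toPerm.hasSum_iff).2 (lp.hasSum_single (by norm_num) y)
  have hxy := hx.prodMk hy
  refine mem_closure_of_tendsto hxy (Eventually.of_forall fun s => ?_)
  exact T.graph.sum_mem fun i _ => hsingle i

/-- The operator $T$ takes the unit vector at `i` to `d (r i)` times the one at `r i`, and the
adjoint brings it back with the conjugate weight. No bound on `d` is assumed: functions of finite
energy may have an unbounded commutator. -/
theorem mem_graph_absSq {r : ι → ι} (hr : Function.Involutive r) {d : ι → ℂ}
    {T : ℓ²(ι, ℂ) →ₗ.[ℂ] ℓ²(ι, ℂ)}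
    (hT : ∀ x y, (x, y) ∈ T.graph → ∀ i, y i = d i * x (r i))
    (hdom : ∀ [DecidableEq ι] (i : ι) (k : ℂ), lp.single 2 i k ∈ T.domain) {x z : ℓ²(ι, ℂ)}
    (hxz : ∀ i, z i = ‖d (r i)‖ ^ 2 * x i) : (x, z) ∈ (absSq T).graph := by
  classical
  have hy : Memℓp (fun i => d i * x (r i)) 2 := by
    rw [memℓp_two_iff, ← hr.toPerm.summable_iff]
    -- The intermediate vector is square summable because $A^2X^2\le X^2+A^4X^2$, where
    -- $A=|d(r\,i)|$ and $X=|x_i|$.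
    refine ((summable_norm_sq x).add (summable_norm_sq z)).of_nonneg_of_le
      (fun i => sq_nonneg _) fun i => ?_
    simp only [Function.comp, Function.Involutive.coe_toPerm, hr i, hxz i, norm_mul, norm_pow,
      Complex.norm_real, norm_norm]
    nlinarith [sq_nonneg (‖x i‖ - ‖d (r i)‖ ^ 2 * ‖x i‖), sq_nonneg (‖d (r i)‖ * ‖x i‖)]
  refine mem_graph_opComp (y := ⟨_, hy⟩) ((mem_graph_closure_iff hr hT hdom).2 fun i => rfl) ?_
  refine mem_graph_adjoint ?_ fun u v huv => ?_
  · intro u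
    refine mem_closure_of_tendsto (lp.hasSum_single (by norm_num) u)
      (Eventually.of_forall fun s => ?_)
    exact T.closure.domain.sum_mem fun i _ => T.le_closure.1 (hdom i _)
  · have hv := (mem_graph_closure_iff hr hT hdom).1 huv
    rw [lp.inner_eq_tsum, lp.inner_eq_tsum, ← hr.toPerm.tsum_eq]
    refine tsum_congr fun i => ?_
    simp only [Function.Involutive.coe_toPerm, hxz, hv i, hr i, RCLike.inner_apply, map_mul,
      map_pow, Complex.conj_ofReal]
    rw [← Complex.mul_conj']
    ring

end Diagonal

/-! ### The zeta operator of the discrete spectral triple -/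

theorem Edge.rev_involutive : Function.Involutive Edge.rev := fun _ => rfl

theorem Edge.length_rev (ϑ : ℝ) (e : Edge) : e.rev.length ϑ = e.length ϑ := by
  simp only [Edge.length, Edge.rev, dist_comm]

theorem mem_graph_dirac {ϑ : ℝ} {x y : Hilb} :
    (x, y) ∈ (dirac ϑ).graph ↔ ∀ e, y e = ((e.length ϑ)⁻¹ : ℝ) * x e.rev := by
  have : (x, y) ∈ (dirac ϑ).graph ↔ (x, edgeFlip y) ∈ (absDirac ϑ).graph := by
    rw [LinearPMap.mem_graph_iff, LinearPMap.mem_graph_iff]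
    refine exists_congr fun u => and_congr_right fun _ => ?_
    constructor
    · rintro rfl; rfl
    · intro h
      change edgeFlip (absDirac ϑ u) = y
      rw [h]; rfl
  rw [this, absDirac, mem_graph_diagOp]
  constructor
  · intro h e
    have h' := h e.rev
    rw [Edge.length_rev] at h'
    exact h'
  · intro h e
    have h' := h e.rev
    rw [Edge.length_rev] at h'
    exact h'

/-- The difference quotient of `f` along an oriented edge. -/
def diffQuot (ϑ : ℝ) (f : Plane → ℂ) (e : Edge) : ℂ :=
  ((e.length ϑ)⁻¹ : ℝ) * (f (e.rev.src ϑ) - f (e.src ϑ))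

/-- The natural domain of the commutator need not be described exactly. This inclusion, together
with the presence of all unit vectors in the domain, determines the closure through
`mem_graph_closure_iff`. -/
theorem diracCommutator_graph {ϑ : ℝ} {f : Plane → ℂ} {x y : Hilb}
    (h : (x, y) ∈ (diracCommutator ϑ f).graph) (e : Edge) : y e = diffQuot ϑ f e * x e.rev := by
  obtain ⟨y, z, hy, hz, rfl⟩ := exists_of_mem_graph_sub h
  obtain ⟨u, hu, huy⟩ := exists_of_mem_graph_opComp hy
  obtain ⟨v, hv, hvz⟩ := exists_of_mem_graph_opComp hz
  have h1 := mem_graph_diagOp.1 hu e.rev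
  have h2 := mem_graph_dirac.1 huy e
  have h3 := mem_graph_dirac.1 hv e
  have h4 := mem_graph_diagOp.1 hvz e
  change y e - z e = _
  rw [h2, h1, h4, h3, diffQuot]
  ring

theorem single_mem_diracCommutator_domain (ϑ : ℝ) (f : Plane → ℂ) [DecidableEq Edge] (e : Edge)
    (k : ℂ) : lp.single 2 e k ∈ (diracCommutator ϑ f).domain := by
  have hdiag : ∀ (a : Edge → ℂ) (i : Edge) (k : ℂ),
      (lp.single 2 i k, lp.single 2 i (a i * k)) ∈ (diagOp a).graph := fun a i k => by
    refine mem_graph_diagOp.2 fun j => ?_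
    by_cases hj : j = i
    · subst hj
      simp
    · rw [lp.single_apply_ne _ _ _ hj, lp.single_apply_ne _ _ _ hj, mul_zero]
  have hdirac : ∀ (i : Edge) (k : ℂ),
      (lp.single 2 i k, edgeFlip (lp.single 2 i (((i.length ϑ)⁻¹ : ℝ) * k))) ∈ (dirac ϑ).graph :=
    fun i k => by
      refine mem_graph_dirac.2 fun j => ?_
      have h := mem_graph_diagOp.1 (hdiag (fun e => ((e.length ϑ)⁻¹ : ℝ)) i k) j.rev
      rw [Edge.length_rev] at h
      exact h
  have hflip : ∀ (i : Edge) (k : ℂ), edgeFlip (lp.single 2 i k) = lp.single 2 i.rev k :=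
    fun i k => by
      refine lp.ext (funext fun j => ?_)
      change (lp.single 2 i k : Hilb) j.rev = _
      by_cases hj : j = i.rev
      · subst hj
        rw [Edge.rev_involutive i, lp.single_apply_self, lp.single_apply_self]
      · have hj' : j.rev ≠ i := fun h => hj (by rw [← h, Edge.rev_involutive])
        rw [lp.single_apply_ne _ _ _ hj, lp.single_apply_ne _ _ _ hj']
  simp only [hflip] at hdirac
  refine LinearPMap.mem_domain_iff.2 ⟨_, mem_graph_sub
    (mem_graph_opComp (hdiag _ e k) (hdirac _ _)) (mem_graph_opComp (hdirac e k) (hdiag _ _ _))⟩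

theorem dist_vertex_le (ϑ : ℝ) (i j : Fin 4) : dist (vertex ϑ i) (vertex ϑ j) ≤ 2 := by
  have h : ∀ i, ‖vertex ϑ i‖ ≤ 1 := fun i => by
    rw [EuclideanSpace.norm_eq]
    refine Real.sqrt_le_one.2 ?_
    fin_cases i <;> simp [vertex, Fin.sum_univ_two, Real.abs_cos_le_one, Real.abs_sin_le_one]
  rw [dist_eq_norm]
  linarith [norm_sub_le (vertex ϑ i) (vertex ϑ j), h i, h j]

theorem Edge.length_nonneg (ϑ : ℝ) (e : Edge) : 0 ≤ e.length ϑ := by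
  unfold Edge.length; positivity

theorem Edge.length_le (ϑ : ℝ) (e : Edge) : e.length ϑ ≤ 2 := by
  unfold Edge.length
  calc _ ≤ (1 : ℝ) * 2 := by
        gcongr
        · exact pow_le_one₀ (by norm_num) (by norm_num)
        · exact dist_vertex_le _ _ _
    _ = 2 := one_mul 2

/-- The zeta operator is trace class as soon as its diagonal is summable. -/
theorem hasTrace_zetaOperator {ϑ : ℝ} {f : Plane → ℂ} {s : ℝ} (hs : 0 ≤ s)
    (hsum : Summable fun e : Edge => e.length ϑ ^ s * ‖diffQuot ϑ f e‖ ^ 2) :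
    HasTrace (zetaOperator ϑ f s)
      (∑' e : Edge, e.length ϑ ^ s * ‖diffQuot ϑ f e‖ ^ 2) := by
  set a : Edge → ℝ := fun e => e.length ϑ ^ s * ‖diffQuot ϑ f e‖ ^ 2 with ha
  have h0 : ∀ e, 0 ≤ a e := fun e =>
    mul_nonneg (Real.rpow_nonneg (e.length_nonneg ϑ) _) (by positivity)
  have hbd : ∀ e, ‖(a e : ℂ)‖ ≤ ∑' e, a e := fun e => by
    rw [Complex.norm_real, Real.norm_of_nonneg (h0 e)]
    exact hsum.le_tsum e fun j _ => h0 j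
  refine ⟨diagCLM _ _ hbd, isPositive_diagCLM a _ hbd h0, eq_toPMap_top_of_mem_graph fun x => ?_,
    fun κ b => hasSum_inner_diagCLM a _ hbd h0 hsum b⟩
  have hpow : ∀ e : Edge, (e.length ϑ)⁻¹ ^ (-s) = e.length ϑ ^ s := fun e => by
    rw [Real.inv_rpow (e.length_nonneg ϑ), Real.rpow_neg (e.length_nonneg ϑ), inv_inv]
  have hb : ∀ e : Edge, ‖(((e.length ϑ)⁻¹ ^ (-s) : ℝ) : ℂ)‖ ≤ 2 ^ s := fun e => by
    rw [hpow, Complex.norm_real, Real.norm_of_nonneg (Real.rpow_nonneg (e.length_nonneg ϑ) _)]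
    exact Real.rpow_le_rpow (e.length_nonneg ϑ) (e.length_le ϑ) hs
  refine mem_graph_opComp (y := ⟨_, memℓp_two_mul hb x⟩) (mem_graph_diagOp.2 fun e => rfl) ?_
  refine mem_graph_absSq Edge.rev_involutive (fun x y h => diracCommutator_graph h)
    (fun e k => single_mem_diracCommutator_domain ϑ f e k) fun e => ?_
  -- `mem_graph_absSq` yields the weight at the reversed edge; reversal only changes the sign of the
  -- difference quotient.
  have hrev : ‖diffQuot ϑ f e.rev‖ = ‖diffQuot ϑ f e‖ := by
    rw [diffQuot, diffQuot, Edge.length_rev, Edge.rev_involutive, norm_mul, norm_mul, norm_sub_rev]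
  change (a e : ℂ) * x e = _ * ((((e.length ϑ)⁻¹ ^ (-s) : ℝ) : ℂ) * x e)
  rw [hrev, hpow, ha]
  push_cast
  ring

/-! ### Sums over cells -/

/-- `∑_{|σ| = n} q[f ∘ w_σ]` for a functional `q` of the values on the vertices. -/
def cellSum {𝕜 : Type} (ϑ : ℝ) (q : (Fin 4 → 𝕜) → ℝ) (n : ℕ) (f : Plane → 𝕜) : ℝ :=
  ∑ σ : Word n, q fun i => f (wordMap ϑ n σ (vertex ϑ i))

theorem formSum_eq_cellSum {𝕜 : Type} [RCLike 𝕜] (ϑ : ℝ) (c : Fin 4 → Fin 4 → ℝ) (n : ℕ)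
    (f : Plane → 𝕜) : formSum ϑ c n f = cellSum ϑ (form c) n f := rfl

theorem cellSum_zero {𝕜 : Type} (ϑ : ℝ) (q : (Fin 4 → 𝕜) → ℝ) (f : Plane → 𝕜) :
    cellSum ϑ q 0 f = q fun i => f (vertex ϑ i) := by
  simp [cellSum, wordMap]

/-- Words are split by their first letter, which is the outermost similarity; this is the form
suited to induction on the level. -/
theorem cellSum_succ {𝕜 : Type} (ϑ : ℝ) (q : (Fin 4 → 𝕜) → ℝ) (n : ℕ) (f : Plane → 𝕜) :
    cellSum ϑ q (n + 1) f = ∑ i, cellSum ϑ q n (f ∘ sim ϑ i) := by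
  simp only [cellSum]
  rw [← Fintype.sum_prod_type', ← (Fin.consEquiv fun _ : Fin (n + 1) => Fin 5).sum_comp]
  refine Finset.sum_congr rfl fun p _ => ?_
  simp [wordMap, Fin.consEquiv]

theorem cellSum_nonneg {𝕜 : Type} {ϑ : ℝ} {q : (Fin 4 → 𝕜) → ℝ} (h : ∀ u, 0 ≤ q u)
    (n : ℕ) (f : Plane → 𝕜) : 0 ≤ cellSum ϑ q n f :=
  Finset.sum_nonneg fun _ _ => h _

theorem cellSum_add {𝕜 : Type} (ϑ : ℝ) (q₁ q₂ : (Fin 4 → 𝕜) → ℝ) (n : ℕ) (f : Plane → 𝕜) :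
    cellSum ϑ (fun u => q₁ u + q₂ u) n f = cellSum ϑ q₁ n f + cellSum ϑ q₂ n f :=
  Finset.sum_add_distrib

theorem cellSum_const_mul {𝕜 : Type} (ϑ k : ℝ) (q : (Fin 4 → 𝕜) → ℝ) (n : ℕ) (f : Plane → 𝕜) :
    cellSum ϑ (fun u => k * q u) n f = k * cellSum ϑ q n f :=
  (Finset.mul_sum _ _ _).symm

/-- Values on the vertices of the five cells of level one which agree where the cells meet:
the vertex `k` of the central cell is the vertex opposite to `k` in the cell at `k`. -/
def IsGlued {𝕜 : Type} (a : Fin 5 → Fin 4 → 𝕜) : Prop :=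
  ∀ k : Fin 4, a 0 k = a k.succ (k + 2)

theorem sim_zero_vertex (ϑ : ℝ) (k : Fin 4) :
    sim ϑ 0 (vertex ϑ k) = sim ϑ k.succ (vertex ϑ (k + 2)) := by
  ext l
  fin_cases k <;> fin_cases l <;> simp [sim, fixedPt, vertex] <;> ring

theorem sim_succ_vertex (ϑ : ℝ) (k : Fin 4) : sim ϑ k.succ (vertex ϑ k) = vertex ϑ k := by
  have : fixedPt ϑ k.succ = vertex ϑ k := by fin_cases k <;> rfl
  simp [sim, this]

theorem isGlued_sim {𝕜 : Type} (ϑ : ℝ) (f : Plane → 𝕜) :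
    IsGlued fun i j => f (sim ϑ i (vertex ϑ j)) := fun k =>
  congrArg f (sim_zero_vertex ϑ k)

/-- An inequality between functionals over one subdivision step propagates to all levels. -/
theorem cellSum_le_cellSum_succ {𝕜 : Type} {ϑ : ℝ} {q₁ q₂ : (Fin 4 → 𝕜) → ℝ}
    (h : ∀ a : Fin 5 → Fin 4 → 𝕜, IsGlued a → q₁ (fun k => a k.succ k) ≤ ∑ i, q₂ (a i))
    (n : ℕ) (f : Plane → 𝕜) : cellSum ϑ q₁ n f ≤ cellSum ϑ q₂ (n + 1) f := by
  induction n generalizing f with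
  | zero =>
    rw [cellSum_succ]
    simp only [cellSum_zero]
    have := h _ (isGlued_sim ϑ f)
    simpa only [sim_succ_vertex, Function.comp_apply] using this
  | succ n ih =>
    rw [cellSum_succ, cellSum_succ _ _ (n + 1)]
    exact Finset.sum_le_sum fun i _ => ih _

/-! ### The quadratic forms -/

theorem sum_edge₀ (F : Fin 4 → Fin 4 → ℝ) :
    ∑ e : Edge₀, F e.1.1 e.1.2 = ∑ i, ∑ j, if i = j then 0 else F i j := by
  rw [← Fintype.sum_prod_type' fun i j => if i = j then 0 else F i j]
  simp only [← ite_not (_ = _)]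
  rw [← Finset.sum_filter (fun p : Fin 4 × Fin 4 => p.1 ≠ p.2)]
  exact (Finset.sum_subtype _ (by simp) fun p : Fin 4 × Fin 4 => F p.1 p.2).symm

/-- The squared defect of the parallelogram rule. -/
def defect {𝕜 : Type} [RCLike 𝕜] (u : Fin 4 → 𝕜) : ℝ := ‖u 0 + u 2 - u 1 - u 3‖ ^ 2

/-- With $s=u_0+u_2$ and $t=u_1+u_3$, the four sides contribute $(s-t)^2$ plus the squares of both
diagonal differences. The factor `2` counts the two orientations. -/
theorem form_eq_of_unit_sides {𝕜 : Type} [RCLike 𝕜] {c : Fin 4 → Fin 4 → ℝ}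
    (hc : ∀ i j, c i j = c j i) (h01 : c 0 1 = 1) (h12 : c 1 2 = 1) (h23 : c 2 3 = 1)
    (h30 : c 3 0 = 1) (u : Fin 4 → 𝕜) :
    form c u = 2 * (defect u + (1 + c 0 2) * ‖u 0 - u 2‖ ^ 2 + (1 + c 1 3) * ‖u 1 - u 3‖ ^ 2) := by
  rw [form, sum_edge₀ fun i j => c i j * ‖u i - u j‖ ^ 2]
  simp only [Fin.sum_univ_four, defect, RCLike.norm_sq_eq_def, map_sub, map_add]
  simp [hc 1 0, hc 2 1, hc 3 2, hc 0 3, hc 2 0, hc 3 1, h01, h12, h23, h30]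
  ring

theorem form_vicsek {𝕜 : Type} [RCLike 𝕜] (H : ℝ) (u : Fin 4 → 𝕜) :
    form (vicsekConductance H) u =
      2 * (defect u + (1 + H) * ‖u 0 - u 2‖ ^ 2 + (1 + H⁻¹) * ‖u 1 - u 3‖ ^ 2) := by
  have := form_eq_of_unit_sides (c := vicsekConductance H)
    (by intro i j; fin_cases i <;> fin_cases j <;> rfl) rfl rfl rfl rfl u
  exact this

theorem defect_nonneg {𝕜 : Type} [RCLike 𝕜] (u : Fin 4 → 𝕜) : 0 ≤ defect u := sq_nonneg _

theorem form_vicsek_nonneg {𝕜 : Type} [RCLike 𝕜] {H : ℝ} (hH : 0 < H) (u : Fin 4 → 𝕜) :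
    0 ≤ form (vicsekConductance H) u := by
  rw [form_vicsek]
  have := defect_nonneg u
  positivity

/-- The two sides differ exactly by the sum of squares `key`. Its terms are the transversal
diagonals of the outer cells, the defect of the series law along each long diagonal, and a coupling
square. With $P$, $Q$ the changes of the diagonal sums $u_0+u_2$, $u_1+u_3$ from the central cell to
the outer boundary, the coupling is $3HP^2+6PQ+3H^{-1}Q^2$. It is a perfect square because the
product of the diagonal conductances is $1$. -/
theorem form_vicsek_sub_real {H : ℝ} (hH : 0 < H) {a : Fin 5 → Fin 4 → ℝ} (ha : IsGlued a) :
    form (vicsekConductance H) (fun k => a k.succ k) +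
        (6 * ∑ k : Fin 4, defect (a k.succ) +
          (3 * (a 0 0 + a 0 2 - a 0 1 - a 0 3) - (a 1 0 + a 3 2 - a 2 1 - a 4 3)) ^ 2) ≤
      3 * ∑ i, form (vicsekConductance H) (a i) := by
  have h0 : a 1 2 = a 0 0 := (ha 0).symm
  have h1 : a 2 3 = a 0 1 := (ha 1).symm
  have h2 : a 3 0 = a 0 2 := (ha 2).symm
  have h3 : a 4 1 = a 0 3 := (ha 3).symm
  have key : 0 ≤ 6 * ((1 + H⁻¹) * (a 1 1 - a 1 3) ^ 2 + (1 + H) * (a 2 0 - a 2 2) ^ 2 +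
      (1 + H⁻¹) * (a 3 1 - a 3 3) ^ 2 + (1 + H) * (a 4 0 - a 4 2) ^ 2) +
      (1 + H) * (3 * (a 0 0 - a 0 2) - (a 1 0 - a 3 2)) ^ 2 +
      (1 + H⁻¹) * (3 * (a 0 1 - a 0 3) - (a 2 1 - a 4 3)) ^ 2 +
      3 * H⁻¹ * (H * (a 1 0 + a 3 2 - a 0 0 - a 0 2) + (a 2 1 + a 4 3 - a 0 1 - a 0 3)) ^ 2 := by
    positivity
  simp only [form_vicsek, defect, Fin.sum_univ_five, Fin.sum_univ_four, Real.norm_eq_abs, sq_abs,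
    Fin.succ_zero_eq_one, Fin.succ_one_eq_two, show Fin.succ (2 : Fin 4) = 3 from rfl,
    show Fin.succ (3 : Fin 4) = 4 from rfl, h0, h1, h2, h3]
  refine sub_nonneg.1 (key.trans_eq ?_)
  field_simp
  ring

theorem form_eq_re_add_im {𝕜 : Type} [RCLike 𝕜] (c : Fin 4 → Fin 4 → ℝ) (u : Fin 4 → 𝕜) :
    form c u = form c (fun i => RCLike.re (u i)) + form c (fun i => RCLike.im (u i)) := by
  simp only [form, ← Finset.sum_add_distrib]
  refine Finset.sum_congr rfl fun e _ => ?_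
  rw [RCLike.norm_sq_eq_def, map_sub, map_sub, Real.norm_eq_abs, Real.norm_eq_abs, sq_abs, sq_abs]
  ring

theorem defect_eq_re_add_im {𝕜 : Type} [RCLike 𝕜] (u : Fin 4 → 𝕜) :
    defect u = defect (fun i => RCLike.re (u i)) + defect (fun i => RCLike.im (u i)) := by
  simp only [defect, RCLike.norm_sq_eq_def (K := 𝕜), map_sub, map_add, Real.norm_eq_abs, sq_abs]
  ring

theorem form_vicsek_sub {𝕜 : Type} [RCLike 𝕜] {H : ℝ} (hH : 0 < H) {a : Fin 5 → Fin 4 → 𝕜}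
    (ha : IsGlued a) :
    form (vicsekConductance H) (fun k => a k.succ k) +
        (6 * ∑ k : Fin 4, defect (a k.succ) +
          ‖3 * (a 0 0 + a 0 2 - a 0 1 - a 0 3) - (a 1 0 + a 3 2 - a 2 1 - a 4 3)‖ ^ 2) ≤
      3 * ∑ i, form (vicsekConductance H) (a i) := by
  have h1 := form_vicsek_sub_real hH (a := fun i j => RCLike.re (a i j))
    (fun k => congrArg RCLike.re (ha k))
  have h2 := form_vicsek_sub_real hH (a := fun i j => RCLike.im (a i j))
    (fun k => congrArg RCLike.im (ha k))
  have h3 : ∀ z : 𝕜, RCLike.re (3 * z) = 3 * RCLike.re z ∧ RCLike.im (3 * z) = 3 * RCLike.im z :=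
    fun z => by
      have : (3 : 𝕜) = ((3 : ℝ) : 𝕜) := (RCLike.ofReal_ofNat 3).symm
      rw [this, RCLike.re_ofReal_mul, RCLike.im_ofReal_mul]
      exact ⟨rfl, rfl⟩
  simp only [form_eq_re_add_im _ (a _), form_eq_re_add_im _ (fun k : Fin 4 => a k.succ k),
    defect_eq_re_add_im (a _), Finset.sum_add_distrib, RCLike.norm_sq_eq_def, map_sub, (h3 _).1,
    (h3 _).2, map_add]
  linarith

theorem form_vicsek_le {𝕜 : Type} [RCLike 𝕜] {H : ℝ} (hH : 0 < H) {a : Fin 5 → Fin 4 → 𝕜}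
    (ha : IsGlued a) : form (vicsekConductance H) (fun k => a k.succ k) ≤
      ∑ i, 3 * form (vicsekConductance H) (a i) := by
  have h := form_vicsek_sub hH ha
  have h1 : 0 ≤ ∑ k : Fin 4, defect (a k.succ) := Finset.sum_nonneg fun _ _ => defect_nonneg _
  rw [← Finset.mul_sum]
  nlinarith [sq_nonneg ‖3 * (a 0 0 + a 0 2 - a 0 1 - a 0 3) - (a 1 0 + a 3 2 - a 2 1 - a 4 3)‖]

/-- Up to the increase of the energy, the defect is contracted by a subdivision. -/
theorem defect_vicsek_le {𝕜 : Type} [RCLike 𝕜] {H : ℝ} (hH : 0 < H) {a : Fin 5 → Fin 4 → 𝕜}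
    (ha : IsGlued a) :
    2 * form (vicsekConductance H) (fun k => a k.succ k) +
        (-(2 / 3)) * defect (fun k => a k.succ k) ≤
      ∑ i, (6 * form (vicsekConductance H) (a i) + (-3) * defect (a i)) := by
  have h := form_vicsek_sub hH ha
  have h1 : 0 ≤ ∑ k : Fin 4, defect (a k.succ) := Finset.sum_nonneg fun _ _ => defect_nonneg _
  -- Write $3z=w+(3z-w)$, where $z$ and $w$ are the parallelogram expressions of the central cell
  -- and of the boundary, and use $(p+q)^2\le 2p^2+2q^2$.
  have h2 : 9 * defect (a 0) ≤ 2 * defect (fun k => a k.succ k) + 2 *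
      ‖3 * (a 0 0 + a 0 2 - a 0 1 - a 0 3) - (a 1 0 + a 3 2 - a 2 1 - a 4 3)‖ ^ 2 := by
    set z := a 0 0 + a 0 2 - a 0 1 - a 0 3
    set w := a 1 0 + a 3 2 - a 2 1 - a 4 3
    change 9 * ‖z‖ ^ 2 ≤ 2 * ‖w‖ ^ 2 + 2 * ‖3 * z - w‖ ^ 2
    have h3 : ‖3 * z‖ ≤ ‖w‖ + ‖3 * z - w‖ := by
      simpa using norm_add_le w (3 * z - w)
    rw [norm_mul, RCLike.norm_ofNat] at h3
    nlinarith [norm_nonneg z, sq_nonneg (‖w‖ - ‖3 * z - w‖)]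
  rw [Finset.sum_add_distrib, ← Finset.mul_sum, ← Finset.mul_sum, Fin.sum_univ_succ (n := 4)
    (f := fun i => defect (a i))]
  nlinarith [sq_nonneg ‖3 * (a 0 0 + a 0 2 - a 0 1 - a 0 3) - (a 1 0 + a 3 2 - a 2 1 - a 4 3)‖]

/-! ### The eigenform property -/

theorem sqrt_two_mul_cos_pi_div_four : √2 * Real.cos (Real.pi / 4) = 1 := by
  rw [Real.cos_pi_div_four]
  have := Real.mul_self_sqrt (show (0 : ℝ) ≤ 2 by norm_num)
  linarith

theorem sqrt_two_mul_sin_pi_div_four : √2 * Real.sin (Real.pi / 4) = 1 := by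
  rw [Real.sin_pi_div_four, ← Real.cos_pi_div_four, sqrt_two_mul_cos_pi_div_four]

/-- On the sector around the vertex `p_k` of the square, the affine function of the coordinate `t`
along `p_k` (normalized to be `1` at `p_k`) with value `u k + (t - 1) * b k`. -/
def sectorAffine (u b : Fin 4 → ℝ) (x : Plane) : ℝ :=
  let X := √2 * x 0
  let Y := √2 * x 1
  if |Y| < X then u 0 + (X - 1) * b 0
  else if |Y| < -X then u 2 + (-X - 1) * b 2
  else if 0 < Y then u 1 + (Y - 1) * b 1
  else u 3 + (-Y - 1) * b 3

theorem sectorAffine_apply (u b : Fin 4 → ℝ) {x : Plane} {X Y : ℝ} (hX : √2 * x 0 = X)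
    (hY : √2 * x 1 = Y) : sectorAffine u b x =
      if |Y| < X then u 0 + (X - 1) * b 0
      else if |Y| < -X then u 2 + (-X - 1) * b 2
      else if 0 < Y then u 1 + (Y - 1) * b 1
      else u 3 + (-Y - 1) * b 3 := by
  subst hX hY; rfl

theorem sectorAffine_vertex (u b : Fin 4 → ℝ) (k : Fin 4) :
    sectorAffine u b (vertex (Real.pi / 4) k) = u k := by
  have hc := sqrt_two_mul_cos_pi_div_four
  have hs := sqrt_two_mul_sin_pi_div_four
  fin_cases k
  · rw [sectorAffine_apply u b (X := 1) (Y := 0)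
      (by simp [vertex, hc, -Real.cos_pi_div_four]) (by simp [vertex])]
    norm_num
  · rw [sectorAffine_apply u b (X := 0) (Y := 1)
      (by simp [vertex]) (by simp [vertex, hs, -Real.sin_pi_div_four])]
    norm_num
  · rw [sectorAffine_apply u b (X := -1) (Y := 0)
      (by simp [vertex, hc, -Real.cos_pi_div_four]) (by simp [vertex])]
    norm_num
    rfl
  · rw [sectorAffine_apply u b (X := 0) (Y := -1)
      (by simp [vertex]) (by simp [vertex, hs, -Real.sin_pi_div_four])]
    norm_num
    rfl

theorem sqrt_two_mul_sim (i : Fin 5) (j : Fin 4) :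
    √2 * sim (Real.pi / 4) i (vertex (Real.pi / 4) j) 0 =
        (![0, 1, 0, -1, 0] i * 2 + ![1, 0, -1, 0] j) / 3 ∧
      √2 * sim (Real.pi / 4) i (vertex (Real.pi / 4) j) 1 =
        (![0, 0, 1, 0, -1] i * 2 + ![0, 1, 0, -1] j) / 3 := by
  have hc := sqrt_two_mul_cos_pi_div_four
  have hs := sqrt_two_mul_sin_pi_div_four
  fin_cases i <;> fin_cases j <;> constructor <;>
    simp [sim, fixedPt, vertex, -Real.cos_pi_div_four, -Real.sin_pi_div_four] <;> linarith

theorem sectorAffine_sim (u b : Fin 4 → ℝ) (k : Fin 4) :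
    sectorAffine u b (sim (Real.pi / 4) k.succ (vertex (Real.pi / 4) k)) = u k ∧
    sectorAffine u b (sim (Real.pi / 4) k.succ (vertex (Real.pi / 4) (k + 1))) = u k - b k / 3 ∧
    sectorAffine u b (sim (Real.pi / 4) k.succ (vertex (Real.pi / 4) (k + 3))) = u k - b k / 3 ∧
    sectorAffine u b (sim (Real.pi / 4) k.succ (vertex (Real.pi / 4) (k + 2))) =
      u k - 2 * b k / 3 := by
  refine ⟨by rw [sim_succ_vertex, sectorAffine_vertex], ?_, ?_, ?_⟩ <;>
  · rw [sectorAffine_apply u b (sqrt_two_mul_sim _ _).1 (sqrt_two_mul_sim _ _).2]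
    fin_cases k <;> simp [abs_div] <;> norm_num <;> ring

theorem isEigenform_vicsek {H : ℝ} (hH : 0 < H) :
    IsEigenform (Real.pi / 4) (vicsekConductance H) (1 / 3) := by
  refine ⟨fun i j hij => ?_, by norm_num, fun u => ?_⟩
  · have hH' := inv_pos.2 hH
    fin_cases i <;> fin_cases j <;> first | exact absurd rfl hij | simp [vicsekConductance, hH]
  · refine IsLeast.isGLB ⟨?_, ?_⟩
    -- The minimizer makes every square lost in `form_vicsek_sub_real` vanish. On outer cells,
    -- affine data kill the defects and the transversal differences. The central defect is a third
    -- of `C`, and $HP+Q=0$ with $P-Q=2C/3$, which gives $P=x$ and $Q=-Hx$. The slopes `b` then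
    -- follow from $b_0-b_2=u_0-u_2$, $b_0+b_2=3x/2$ and the analogous pair for `1`, `3`.
    · set C := u 0 + u 2 - u 1 - u 3 with hC
      set x := 2 * C / (3 * (1 + H)) with hx
      set b : Fin 4 → ℝ := ![(u 0 - u 2) / 2 + 3 * x / 4, (u 1 - u 3) / 2 - 3 * H * x / 4,
        -(u 0 - u 2) / 2 + 3 * x / 4, -(u 1 - u 3) / 2 - 3 * H * x / 4] with hb
      refine ⟨sectorAffine u b, sectorAffine_vertex u b, ?_⟩
      rw [formSum_eq_cellSum, cellSum_succ]
      simp only [cellSum_zero, Function.comp_apply]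
      rw [Fin.sum_univ_succ]
      simp only [Fin.sum_univ_four, form_vicsek, defect, sim_zero_vertex,
        (sectorAffine_sim u b _).2.2.2]
      have e0 := sectorAffine_sim u b 0
      have e1 := sectorAffine_sim u b 1
      have e2 := sectorAffine_sim u b 2
      have e3 := sectorAffine_sim u b 3
      simp only [show (0 : Fin 4) + 1 = 1 from rfl, show (0 : Fin 4) + 2 = 2 from rfl,
        show (0 : Fin 4) + 3 = 3 from rfl, show (1 : Fin 4) + 1 = 2 from rfl,
        show (1 : Fin 4) + 2 = 3 from rfl, show (1 : Fin 4) + 3 = 0 from rfl,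
        show (2 : Fin 4) + 1 = 3 from rfl, show (2 : Fin 4) + 2 = 0 from rfl,
        show (2 : Fin 4) + 3 = 1 from rfl, show (3 : Fin 4) + 1 = 0 from rfl,
        show (3 : Fin 4) + 2 = 1 from rfl, show (3 : Fin 4) + 3 = 2 from rfl] at e0 e1 e2 e3
      simp only [e0, e1, e2, e3, Real.norm_eq_abs, sq_abs]
      have b0 : b 0 = (u 0 - u 2) / 2 + 3 * x / 4 := rfl
      have b1 : b 1 = (u 1 - u 3) / 2 - 3 * H * x / 4 := rfl
      have b2 : b 2 = -(u 0 - u 2) / 2 + 3 * x / 4 := rfl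
      have b3 : b 3 = -(u 1 - u 3) / 2 - 3 * H * x / 4 := rfl
      rw [b0, b1, b2, b3, hx, hC]
      field_simp
      ring
    · rintro t ⟨g, hg, rfl⟩
      have h := cellSum_le_cellSum_succ (ϑ := Real.pi / 4)
        (q₂ := fun u => 3 * form (vicsekConductance H) u)
        (fun a ha => form_vicsek_le (𝕜 := ℝ) hH ha) 0 g
      rw [cellSum_const_mul, cellSum_zero, ← formSum_eq_cellSum] at h
      simp only [hg] at h
      linarith

/-! ### The affine deformation -/

theorem deform_vertex (ϑ : ℝ) (k : Fin 4) : deform ϑ (vertex (Real.pi / 4) k) = vertex ϑ k := by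
  have hc := sqrt_two_mul_cos_pi_div_four
  have hs := sqrt_two_mul_sin_pi_div_four
  ext l
  fin_cases k <;> fin_cases l <;>
    simp [deform, vertex, -Real.cos_pi_div_four, -Real.sin_pi_div_four] <;>
    first
    | linear_combination Real.cos ϑ * hc
    | linear_combination Real.sin ϑ * hs

theorem deform_fixedPt (ϑ : ℝ) (i : Fin 5) :
    deform ϑ (fixedPt (Real.pi / 4) i) = fixedPt ϑ i := by
  refine Fin.cases ?_ (fun k => ?_) i
  · ext l
    fin_cases l <;> simp [deform, fixedPt]
  · have : ∀ ϑ, fixedPt ϑ k.succ = vertex ϑ k := fun ϑ => by fin_cases k <;> rfl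
    rw [this, this, deform_vertex]

theorem deform_sim (ϑ : ℝ) (i : Fin 5) (x : Plane) :
    deform ϑ (sim (Real.pi / 4) i x) = sim ϑ i (deform ϑ x) := by
  rw [sim, sim, ← deform_fixedPt ϑ i]
  ext l
  fin_cases l <;> simp [deform] <;> ring

theorem deform_wordMap (ϑ : ℝ) (n : ℕ) (σ : Word n) (x : Plane) :
    deform ϑ (wordMap (Real.pi / 4) n σ x) = wordMap ϑ n σ (deform ϑ x) := by
  induction n with
  | zero => rfl
  | succ n ih => simp only [wordMap, Function.comp_apply, deform_sim, ih]

theorem formSum_comp_deform (ϑ : ℝ) (c : Fin 4 → Fin 4 → ℝ) (n : ℕ) (f : Plane → ℂ) :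
    formSum (Real.pi / 4) c n (f ∘ deform ϑ) = formSum ϑ c n f := by
  simp only [formSum, Function.comp_apply, deform_wordMap, deform_vertex]

theorem continuous_deform (ϑ : ℝ) : Continuous (deform ϑ) := by
  unfold deform
  fun_prop

/-- The affine map conjugates the two families of similarities, so the image solves the fixed set
equation of the rhombus, whose solution is unique. -/
theorem deform_image_fractal (ϑ : ℝ) : deform ϑ '' fractal (Real.pi / 4) = fractal ϑ := by
  refine (existsUnique_fractal ϑ).unique ?_ (fractal_spec ϑ)
  obtain ⟨hne, hcp, heq⟩ := fractal_spec (Real.pi / 4)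
  refine ⟨hne.image _, hcp.image (continuous_deform ϑ), ?_⟩
  conv_lhs => rw [heq]
  simp only [Set.image_iUnion, Set.image_image, deform_sim]

/-! ### The parameter `H` -/

theorem sin_pos_cos_pos {ϑ : ℝ} (h : ϑ ∈ Set.Ioo 0 (Real.pi / 2)) :
    0 < Real.sin ϑ ∧ 0 < Real.cos ϑ :=
  ⟨Real.sin_pos_of_pos_of_lt_pi h.1 (by linarith [h.2, Real.pi_pos]),
    Real.cos_pos_of_mem_Ioo ⟨by linarith [h.1, Real.pi_pos], h.2⟩⟩

theorem paramH_eq {ϑ : ℝ} (h : ϑ ∈ Set.Ioo 0 (Real.pi / 2)) :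
    paramH ϑ = (2 + (Real.cos ϑ)⁻¹) / (2 + (Real.sin ϑ)⁻¹) := by
  obtain ⟨hs, hc⟩ := sin_pos_cos_pos h
  have h1 : √(1 + Real.tan ϑ ^ 2) = (Real.cos ϑ)⁻¹ := by
    rw [Real.sqrt_eq_iff_mul_self_eq_of_pos (inv_pos.2 hc), Real.tan_eq_sin_div_cos]
    field_simp
    linarith [Real.sin_sq_add_cos_sq ϑ]
  have h2 : √(1 + Real.cot ϑ ^ 2) = (Real.sin ϑ)⁻¹ := by
    rw [Real.sqrt_eq_iff_mul_self_eq_of_pos (inv_pos.2 hs), Real.cot_eq_cos_div_sin]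
    field_simp
    linarith [Real.sin_sq_add_cos_sq ϑ]
  rw [paramH, h1, h2]

theorem paramH_pos {ϑ : ℝ} (h : ϑ ∈ Set.Ioo 0 (Real.pi / 2)) : 0 < paramH ϑ := by
  obtain ⟨hs, hc⟩ := sin_pos_cos_pos h
  rw [paramH_eq h]
  positivity

/-- On this interval the secant increases and the cosecant decreases. -/
theorem paramH_strictMonoOn : StrictMonoOn paramH (Set.Ioo 0 (Real.pi / 2)) := by
  intro ϑ₁ h₁ ϑ₂ h₂ hlt
  obtain ⟨hs₁, hc₁⟩ := sin_pos_cos_pos h₁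
  obtain ⟨hs₂, hc₂⟩ := sin_pos_cos_pos h₂
  have hs : Real.sin ϑ₁ < Real.sin ϑ₂ :=
    Real.sin_lt_sin_of_lt_of_le_pi_div_two (by linarith [h₁.1, Real.pi_pos]) h₂.2.le hlt
  have hc : Real.cos ϑ₂ < Real.cos ϑ₁ :=
    Real.cos_lt_cos_of_nonneg_of_le_pi_div_two h₁.1.le h₂.2.le hlt
  rw [paramH_eq h₁, paramH_eq h₂]
  gcongr

theorem existsUnique_paramH {H : ℝ} (hH : 0 < H) :
    ∃! ϑ : ℝ, ϑ ∈ Set.Ioo (0 : ℝ) (Real.pi / 2) ∧ paramH ϑ = H := by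
  -- The equation `paramH ϑ = H` with denominators cleared. Unlike the quotient, `F` is continuous
  -- up to the endpoints, where its values are $-H$ and $1$.
  let F : ℝ → ℝ := fun ϑ =>
    Real.sin ϑ * (2 * Real.cos ϑ + 1) - H * (Real.cos ϑ * (2 * Real.sin ϑ + 1))
  have hF : Continuous F := by fun_prop
  have h0 : (0 : ℝ) ∈ Set.Ioo (F 0) (F (Real.pi / 2)) := by simp [F, hH]
  obtain ⟨ϑ, hϑ, hFϑ⟩ := intermediate_value_Ioo (by positivity) hF.continuousOn h0
  refine ⟨ϑ, ⟨hϑ, ?_⟩, fun ϑ' h' => paramH_strictMonoOn.injOn h'.1 hϑ ?_⟩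
  all_goals
    have : paramH ϑ = H := by
      obtain ⟨hs, hc⟩ := sin_pos_cos_pos hϑ
      rw [paramH_eq hϑ]
      simp only [F] at hFϑ
      field_simp
      linarith
  · exact this
  · rw [h'.2, this]

/-! ### Renormalized energies -/

/-- The sequence `3^n ∑_{|σ| = n} q[f ∘ w_σ]`. -/
def scaledSum (ϑ : ℝ) (q : (Fin 4 → ℂ) → ℝ) (f : Plane → ℂ) (n : ℕ) : ℝ :=
  3 ^ n * cellSum ϑ q n f

theorem inv_pow_mul_formSum (ϑ : ℝ) (c : Fin 4 → Fin 4 → ℝ) (n : ℕ) (f : Plane → ℂ) :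
    ((1 / 3 : ℝ) ^ n)⁻¹ * formSum ϑ c n f = scaledSum ϑ (form c) f n := by
  rw [scaledSum, formSum_eq_cellSum, one_div, inv_pow, inv_inv]

theorem scaledSum_nonneg {ϑ : ℝ} {q : (Fin 4 → ℂ) → ℝ} (h : ∀ u, 0 ≤ q u) (f : Plane → ℂ)
    (n : ℕ) : 0 ≤ scaledSum ϑ q f n :=
  mul_nonneg (by positivity) (cellSum_nonneg h n f)

theorem monotone_scaledSum {H : ℝ} (hH : 0 < H) (ϑ : ℝ) (f : Plane → ℂ) :
    Monotone (scaledSum ϑ (form (vicsekConductance H)) f) := by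
  refine monotone_nat_of_le_succ fun n => ?_
  have h := cellSum_le_cellSum_succ (ϑ := ϑ)
    (q₂ := fun u => 3 * form (vicsekConductance H) u)
    (fun a ha => form_vicsek_le (𝕜 := ℂ) hH ha) n f
  rw [cellSum_const_mul] at h
  rw [scaledSum, scaledSum, pow_succ, mul_assoc]
  gcongr

/-- The renormalized sums are monotone, so the upper limit is a supremum and a genuine limit. -/
theorem tendsto_limitEnergy {H : ℝ} (hH : 0 < H) (ϑ : ℝ) (f : Plane → ℂ) :
    Tendsto (fun n : ℕ => ENNReal.ofReal
        (((1 / 3 : ℝ) ^ n)⁻¹ * formSum ϑ (vicsekConductance H) n f)) atTop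
      (𝓝 (limitEnergy ϑ (vicsekConductance H) (1 / 3) f)) := by
  have h : Monotone fun n : ℕ => ENNReal.ofReal
      (((1 / 3 : ℝ) ^ n)⁻¹ * formSum ϑ (vicsekConductance H) n f) := fun m n hmn => by
    simp only [inv_pow_mul_formSum]
    exact ENNReal.ofReal_le_ofReal (monotone_scaledSum hH ϑ f hmn)
  have ht := tendsto_atTop_iSup h
  rwa [← ht.limsup_eq] at ht

theorem tendsto_scaledSum_form {H : ℝ} (hH : 0 < H) {ϑ : ℝ} {f : Plane → ℂ}
    (hf : limitEnergy ϑ (vicsekConductance H) (1 / 3) f < ⊤) :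
    Tendsto (scaledSum ϑ (form (vicsekConductance H)) f) atTop
      (𝓝 (limitEnergy ϑ (vicsekConductance H) (1 / 3) f).toReal) := by
  have h := (ENNReal.tendsto_toReal hf.ne).comp (tendsto_limitEnergy hH ϑ f)
  refine h.congr fun n => ?_
  rw [Function.comp_apply, inv_pow_mul_formSum,
    ENNReal.toReal_ofReal (scaledSum_nonneg (form_vicsek_nonneg hH) f n)]

theorem scaledSum_defect_succ_le {H : ℝ} (hH : 0 < H) (ϑ : ℝ) (f : Plane → ℂ) (n : ℕ) :
    3 * scaledSum ϑ defect f (n + 1) ≤ 2 * scaledSum ϑ defect f n +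
      6 * (scaledSum ϑ (form (vicsekConductance H)) f (n + 1) -
        scaledSum ϑ (form (vicsekConductance H)) f n) := by
  have h := cellSum_le_cellSum_succ (ϑ := ϑ)
    (q₁ := fun u => 2 * form (vicsekConductance H) u + (-(2 / 3)) * defect u)
    (q₂ := fun u => 6 * form (vicsekConductance H) u + (-3) * defect u)
    (fun a ha => defect_vicsek_le (𝕜 := ℂ) hH ha) n f
  simp only [cellSum_add, cellSum_const_mul] at h
  have h' := mul_le_mul_of_nonneg_left h (show (0 : ℝ) ≤ 3 * 3 ^ n by positivity)
  simp only [scaledSum, pow_succ]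
  linarith

/-- For functions of finite energy the defect carries no energy in the limit. -/
theorem tendsto_scaledSum_defect {H : ℝ} (hH : 0 < H) {ϑ : ℝ} {f : Plane → ℂ}
    (hf : limitEnergy ϑ (vicsekConductance H) (1 / 3) f < ⊤) :
    Tendsto (scaledSum ϑ defect f) atTop (𝓝 0) := by
  set E := scaledSum ϑ (form (vicsekConductance H)) f
  set Y := scaledSum ϑ defect f
  have hY : ∀ n, 0 ≤ Y n := scaledSum_nonneg defect_nonneg f
  have hE : ∀ n, E n ≤ (limitEnergy ϑ (vicsekConductance H) (1 / 3) f).toReal := fun n =>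
    (monotone_scaledSum hH ϑ f).ge_of_tendsto (tendsto_scaledSum_form hH hf) n
  -- Summing $3Y_{n+1}\le 2Y_n+6(E_{n+1}-E_n)$ telescopes the energies; the bounded energies then
  -- make the defects summable.
  have hsum : ∀ n, ∑ i ∈ Finset.range n, Y i ≤ 3 * Y 0 + 6 * (E n - E 0) - 3 * Y n := fun n => by
    induction n with
    | zero => simp
    | succ n ih =>
      rw [Finset.sum_range_succ]
      have := scaledSum_defect_succ_le hH ϑ f n
      linarith
  refine (summable_of_sum_range_le (c := 3 * Y 0 + 6 *
    ((limitEnergy ϑ (vicsekConductance H) (1 / 3) f).toReal - E 0)) hY fun n => ?_).tendsto_atTop_zero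
  linarith [hsum n, hE n, hY n]

/-! ### Comparison of the conductances of the Dirac operator with the eigenform. -/

/-- The conductances `ℓ(e)⁻¹`. -/
def lengthConductance (ϑ : ℝ) (i j : Fin 4) : ℝ := (dist (vertex ϑ i) (vertex ϑ j))⁻¹

/-- Matching the two diagonal terms requires $\kappa(1+H)=1+\frac1{2\cos\vartheta}$ and
$\kappa(1+H^{-1})=1+\frac1{2\sin\vartheta}$. The quotient of these equations forces the value of
$H$, and then $\kappa$; the mismatch on the sides is a multiple of the defect alone. -/
theorem form_lengthConductance {ϑ : ℝ} (h : ϑ ∈ Set.Ioo 0 (Real.pi / 2)) {κ : ℝ}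
    (hκ : κ = (2 + (Real.cos ϑ)⁻¹) * (2 + (Real.sin ϑ)⁻¹) /
      (2 * (4 + (Real.cos ϑ)⁻¹ + (Real.sin ϑ)⁻¹))) (u : Fin 4 → ℂ) :
    form (lengthConductance ϑ) u =
      κ * form (vicsekConductance (paramH ϑ)) u + 2 * (1 - κ) * defect u := by
  obtain ⟨hs, hc⟩ := sin_pos_cos_pos h
  have hside : ∀ i : Fin 4, lengthConductance ϑ i (i + 1) = 1 := fun i => by
    rw [lengthConductance, inv_eq_one, EuclideanSpace.dist_eq, Real.sqrt_eq_one]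
    fin_cases i <;> simp [vertex, Fin.sum_univ_two, Real.dist_eq]
  have h02 : lengthConductance ϑ 0 2 = (2 * Real.cos ϑ)⁻¹ := by
    rw [lengthConductance, EuclideanSpace.dist_eq, inv_inj,
      Real.sqrt_eq_iff_mul_self_eq_of_pos (by positivity)]
    simp [vertex, Fin.sum_univ_two, Real.dist_eq]
    ring
  have h13 : lengthConductance ϑ 1 3 = (2 * Real.sin ϑ)⁻¹ := by
    rw [lengthConductance, EuclideanSpace.dist_eq, inv_inj,
      Real.sqrt_eq_iff_mul_self_eq_of_pos (by positivity)]
    simp [vertex, Fin.sum_univ_two, Real.dist_eq]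
    ring
  have h1 : 1 + (2 * Real.cos ϑ)⁻¹ = κ * (1 + paramH ϑ) := by
    rw [hκ, paramH_eq h]
    field_simp
    ring
  have h2 : 1 + (2 * Real.sin ϑ)⁻¹ = κ * (1 + (paramH ϑ)⁻¹) := by
    rw [hκ, paramH_eq h]
    field_simp
    ring
  rw [form_eq_of_unit_sides (fun i j => by rw [lengthConductance, dist_comm, lengthConductance])
    (hside 0) (hside 1) (hside 2) (hside 3), form_vicsek, h02, h13, h1, h2]
  ring

theorem tendsto_scaledSum_lengthConductance {ϑ : ℝ} (h : ϑ ∈ Set.Ioo 0 (Real.pi / 2)) {κ : ℝ}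
    (hκ : κ = (2 + (Real.cos ϑ)⁻¹) * (2 + (Real.sin ϑ)⁻¹) /
      (2 * (4 + (Real.cos ϑ)⁻¹ + (Real.sin ϑ)⁻¹))) {f : Plane → ℂ}
    (hf : limitEnergy ϑ (vicsekConductance (paramH ϑ)) (1 / 3) f < ⊤) :
    Tendsto (scaledSum ϑ (form (lengthConductance ϑ)) f) atTop
      (𝓝 (κ * (limitEnergy ϑ (vicsekConductance (paramH ϑ)) (1 / 3) f).toReal)) := by
  have h1 := ((tendsto_scaledSum_form (paramH_pos h) hf).const_mul κ).add
    ((tendsto_scaledSum_defect (paramH_pos h) hf).const_mul (2 * (1 - κ)))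
  rw [mul_zero, add_zero] at h1
  refine h1.congr fun n => ?_
  simp only [scaledSum, funext (form_lengthConductance h hκ), cellSum_add, cellSum_const_mul]
  ring

/-! ### An Abelian theorem -/

theorem summable_mul_pow_of_tendsto {τ : ℕ → ℝ} {l r : ℝ} (hτ : Tendsto τ atTop (𝓝 l))
    (hr0 : 0 ≤ r) (hr1 : r < 1) : Summable fun n => τ n * r ^ n := by
  obtain ⟨C, hC⟩ := hτ.norm.bddAbove_range
  refine Summable.of_norm_bounded ((summable_geometric_of_lt_one hr0 hr1).mul_left C) fun n => ?_
  rw [norm_mul, norm_pow, Real.norm_of_nonneg hr0]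
  gcongr
  exact hC ⟨n, rfl⟩

theorem tendsto_one_sub_mul_tsum {τ : ℕ → ℝ} {l : ℝ} (hτ : Tendsto τ atTop (𝓝 l)) :
    Tendsto (fun r : ℝ => (1 - r) * ∑' n, τ n * r ^ n) (𝓝[<] 1) (𝓝 l) := by
  -- The increments of `τ`, starting with `τ 0`: their partial sums are `τ`, and
  -- $(1-r)\sum\tau_nr^n=\sum d_nr^n$, which reduces the claim to Abel's limit theorem.
  let d : ℕ → ℝ := fun n => Nat.casesOn n (τ 0) fun m => τ (m + 1) - τ m
  have hd : ∀ n, ∑ i ∈ Finset.range (n + 1), d i = τ n := fun n => by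
    induction n with
    | zero => simp [d]
    | succ n ih =>
      rw [Finset.sum_range_succ, ih]
      simp [d]
  have hpart : Tendsto (fun n => ∑ i ∈ Finset.range n, d i) atTop (𝓝 l) :=
    (tendsto_add_atTop_iff_nat 1).1 (by simpa only [hd] using hτ)
  refine (Real.tendsto_tsum_powerSeries_nhdsWithin_lt hpart).congr' ?_
  filter_upwards [Ioo_mem_nhdsLT (show (0 : ℝ) < 1 by norm_num)] with r hr
  have hs := summable_mul_pow_of_tendsto hτ hr.1.le hr.2
  have hs' : Summable fun n => τ (n + 1) * r ^ (n + 1) := (summable_nat_add_iff 1).2 hs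
  have he : ∀ n, d (n + 1) * r ^ (n + 1) = τ (n + 1) * r ^ (n + 1) - r * (τ n * r ^ n) := fun n => by
    simp only [d, pow_succ]
    ring
  have hds : Summable fun n => d n * r ^ n :=
    (summable_nat_add_iff 1).1 (by simpa only [he] using hs'.sub (hs.mul_left r))
  rw [hds.tsum_eq_zero_add]
  simp only [he]
  rw [hs'.tsum_sub (hs.mul_left r), tsum_mul_left]
  have h0 := hs.tsum_eq_zero_add
  have hd0 : d 0 = τ 0 := rfl
  rw [hd0]
  linarith

/-- Substitute $r=3^{-(s-1)}$ and use $(s-1)/(1-r)\to 1/\log 3$, the inverse of minus the derivative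
of $r$ at $s=1$. -/
theorem tendsto_sub_one_mul_tsum {τ : ℕ → ℝ} {l : ℝ} (hτ : Tendsto τ atTop (𝓝 l)) :
    Tendsto (fun s : ℝ => (s - 1) * ∑' n, τ n * ((1 / 3 : ℝ) ^ (s - 1)) ^ n) (𝓝[>] 1)
      (𝓝 (l / Real.log 3)) := by
  have hlog : 0 < Real.log 3 := Real.log_pos (by norm_num)
  have hder : HasDerivAt (fun s : ℝ => (1 / 3 : ℝ) ^ (s - 1)) (-Real.log 3) 1 := by
    have h := ((hasDerivAt_id (1 : ℝ)).sub_const 1).const_rpow (show (0 : ℝ) < 1 / 3 by norm_num)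
    simpa using h
  have hlt : ∀ s : ℝ, 1 < s → (1 / 3 : ℝ) ^ (s - 1) < 1 := fun s hs =>
    Real.rpow_lt_one (by norm_num) (by norm_num) (by linarith)
  have hr : Tendsto (fun s : ℝ => (1 / 3 : ℝ) ^ (s - 1)) (𝓝[>] 1) (𝓝[<] 1) := by
    refine tendsto_nhdsWithin_iff.2 ⟨?_, ?_⟩
    · have := hder.continuousAt.tendsto.mono_left (nhdsWithin_le_nhds (s := Set.Ioi (1 : ℝ)))
      simpa using this
    · filter_upwards [self_mem_nhdsWithin] with s hs using hlt s hs
  have hslope := (hasDerivAt_iff_tendsto_slope.1 hder).mono_left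
    (nhdsWithin_mono 1 (show Set.Ioi (1 : ℝ) ⊆ {1}ᶜ from fun s hs => ne_of_gt hs))
  have hinv := (hslope.inv₀ (by linarith)).neg
  have hmul := hinv.mul ((tendsto_one_sub_mul_tsum hτ).comp hr)
  have hl : -(-Real.log 3)⁻¹ * l = l / Real.log 3 := by field_simp
  rw [hl] at hmul
  refine hmul.congr' ?_
  filter_upwards [self_mem_nhdsWithin] with s hs
  have h1 : s - 1 ≠ 0 := by have : (1 : ℝ) < s := hs; linarith
  have h2 : 1 - (1 / 3 : ℝ) ^ (s - 1) ≠ 0 := by have := hlt s hs; linarith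
  have h3 : (1 / 3 : ℝ) ^ (s - 1) - 1 ≠ 0 := fun h => h2 (by linarith)
  simp only [slope, vsub_eq_sub, sub_self, Real.rpow_zero, smul_eq_mul, Function.comp_apply]
  field_simp
  ring

/-! ### The zeta function -/

theorem hasSum_edge_of_nonneg {F : Edge → ℝ} (hF : ∀ e, 0 ≤ F e) {G : ℕ → ℝ}
    (hG : ∀ n, ∑ σ : Word n, ∑ e : Edge₀, F (⟨n, σ⟩, e) = G n) (hs : Summable G) :
    HasSum F (∑' n, G n) := by
  have h1 : Summable fun w : Σ n, Word n => ∑ e : Edge₀, F (w, e) := by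
    rw [summable_sigma_of_nonneg fun w => Finset.sum_nonneg fun e _ => hF _]
    refine ⟨fun n => (hasSum_fintype _).summable, ?_⟩
    simpa only [tsum_fintype, hG] using hs
  have h2 : Summable F := by
    rw [summable_prod_of_nonneg hF]
    refine ⟨fun w => (hasSum_fintype _).summable, ?_⟩
    simpa only [tsum_fintype] using h1
  rw [h2.hasSum_iff, h2.tsum_prod]
  simp only [tsum_fintype]
  rw [h1.tsum_sigma]
  simp only [tsum_fintype, hG]

theorem vertex_injective {ϑ : ℝ} (h : ϑ ∈ Set.Ioo 0 (Real.pi / 2)) :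
    Function.Injective (vertex ϑ) := by
  obtain ⟨hs, hc⟩ := sin_pos_cos_pos h
  intro i j hij
  have h0 := congrArg (fun p : Plane => p 0) hij
  have h1 := congrArg (fun p : Plane => p 1) hij
  fin_cases i <;> fin_cases j <;> first | rfl | (simp [vertex] at h0 h1; linarith)

/-- The main part of the diagonal entries of the zeta operator. -/
def edgeTerm (ϑ : ℝ) (f : Plane → ℂ) (s : ℝ) (e : Edge) : ℝ :=
  ((1 / 3 : ℝ) ^ (s - 1)) ^ e.1.1 * 3 ^ e.1.1 *
    (lengthConductance ϑ e.2.1.1 e.2.1.2 * ‖f (e.src ϑ) - f (e.rev.src ϑ)‖ ^ 2)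

theorem edgeTerm_nonneg (ϑ : ℝ) (f : Plane → ℂ) (s : ℝ) (e : Edge) : 0 ≤ edgeTerm ϑ f s e := by
  unfold edgeTerm lengthConductance
  positivity

/-- The powers split as $3^{-ns}3^{2n}=3^{-n(s-1)}3^n$ and $\ell^s\ell^{-2}=\ell^{s-1}\ell^{-1}$.
Only the factor $\ell^{s-1}$ keeps `edgeTerm` from being the exact diagonal entry. -/
theorem length_rpow_mul_diffQuot {ϑ : ℝ} (h : ϑ ∈ Set.Ioo 0 (Real.pi / 2)) (f : Plane → ℂ)
    (s : ℝ) (e : Edge) : e.length ϑ ^ s * ‖diffQuot ϑ f e‖ ^ 2 =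
      dist (vertex ϑ e.2.1.1) (vertex ϑ e.2.1.2) ^ (s - 1) * edgeTerm ϑ f s e := by
  have hd : 0 < dist (vertex ϑ e.2.1.1) (vertex ϑ e.2.1.2) :=
    dist_pos.2 fun he => e.2.2 (vertex_injective h he)
  have hpow : ((1 / 3 : ℝ) ^ e.1.1) ^ s = ((1 / 3 : ℝ) ^ (s - 1)) ^ e.1.1 * (1 / 3) ^ e.1.1 := by
    rw [← mul_pow, ← Real.rpow_add_one (by norm_num), sub_add_cancel, ← Real.rpow_natCast,
      ← Real.rpow_natCast, ← Real.rpow_mul (by norm_num), ← Real.rpow_mul (by norm_num), mul_comm]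
  have hdpow : dist (vertex ϑ e.2.1.1) (vertex ϑ e.2.1.2) ^ s =
      dist (vertex ϑ e.2.1.1) (vertex ϑ e.2.1.2) ^ (s - 1) *
        dist (vertex ϑ e.2.1.1) (vertex ϑ e.2.1.2) := by
    rw [← Real.rpow_add_one hd.ne', sub_add_cancel]
  rw [diffQuot, norm_mul, Complex.norm_real, norm_sub_rev, edgeTerm, lengthConductance,
    Edge.length, Real.mul_rpow (by positivity) hd.le, hpow, hdpow, norm_inv,
    Real.norm_of_nonneg (by positivity), one_div, inv_pow]
  field_simp

theorem hasSum_edgeTerm {ϑ : ℝ} {f : Plane → ℂ} {l : ℝ}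
    (hf : Tendsto (scaledSum ϑ (form (lengthConductance ϑ)) f) atTop (𝓝 l)) {s : ℝ} (hs : 1 < s) :
    HasSum (edgeTerm ϑ f s)
      (∑' n, scaledSum ϑ (form (lengthConductance ϑ)) f n * ((1 / 3 : ℝ) ^ (s - 1)) ^ n) := by
  refine hasSum_edge_of_nonneg (edgeTerm_nonneg ϑ f s) (fun n => ?_)
    (summable_mul_pow_of_tendsto hf (by positivity)
      (Real.rpow_lt_one (by norm_num) (by norm_num) (by linarith)))
  simp only [edgeTerm, ← Finset.mul_sum]
  rw [scaledSum, mul_comm, mul_comm (3 ^ n : ℝ), mul_assoc, mul_comm (3 ^ n : ℝ)]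
  rfl

/-- The factors $\ell(e)^{s-1}$ lie between $m^{s-1}$ and $2^{s-1}$, where $m$ is the least length
in $E_0$. Both bounds tend to $1$, so the trace is squeezed onto the series treated by the Abelian
theorem. -/
theorem exists_zeta {ϑ : ℝ} (h : ϑ ∈ Set.Ioo 0 (Real.pi / 2)) {f : Plane → ℂ} {l : ℝ}
    (hf : Tendsto (scaledSum ϑ (form (lengthConductance ϑ)) f) atTop (𝓝 l)) :
    ∃ Z : ℝ → ℝ, (∀ s : ℝ, 1 < s → HasTrace (zetaOperator ϑ f s) (Z s)) ∧
      Tendsto (fun s : ℝ => (s - 1) * Z s) (𝓝[>] 1) (𝓝 (l / Real.log 3)) := by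
  obtain ⟨m, hm0, hm⟩ : ∃ m : ℝ, 0 < m ∧
      ∀ e : Edge₀, m ≤ dist (vertex ϑ e.1.1) (vertex ϑ e.1.2) := by
    have : Nonempty Edge₀ := ⟨⟨(0, 1), by decide⟩⟩
    obtain ⟨e₀, he₀⟩ := Finite.exists_min fun e : Edge₀ => dist (vertex ϑ e.1.1) (vertex ϑ e.1.2)
    exact ⟨_, dist_pos.2 fun he => e₀.2 (vertex_injective h he), he₀⟩
  set A : ℝ → ℝ := fun s =>
    ∑' n, scaledSum ϑ (form (lengthConductance ϑ)) f n * ((1 / 3 : ℝ) ^ (s - 1)) ^ n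
  have hA : ∀ s, 1 < s → HasSum (edgeTerm ϑ f s) (A s) := fun s hs => hasSum_edgeTerm hf hs
  set z : ℝ → Edge → ℝ := fun s e => e.length ϑ ^ s * ‖diffQuot ϑ f e‖ ^ 2
  have hlow : ∀ s, 1 < s → ∀ e, m ^ (s - 1) * edgeTerm ϑ f s e ≤ z s e := fun s hs e => by
    simp only [z, length_rpow_mul_diffQuot h]
    exact mul_le_mul_of_nonneg_right
      (Real.rpow_le_rpow hm0.le (hm e.2) (by linarith)) (edgeTerm_nonneg ϑ f s e)
  have hup : ∀ s, 1 < s → ∀ e, z s e ≤ 2 ^ (s - 1) * edgeTerm ϑ f s e := fun s hs e => by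
    simp only [z, length_rpow_mul_diffQuot h]
    exact mul_le_mul_of_nonneg_right
      (Real.rpow_le_rpow dist_nonneg (dist_vertex_le _ _ _) (by linarith)) (edgeTerm_nonneg ϑ f s e)
  have hz : ∀ s, 1 < s → Summable (z s) := fun s hs =>
    ((hA s hs).mul_left (2 ^ (s - 1))).summable.of_nonneg_of_le
      (fun e => (mul_nonneg (by positivity) (edgeTerm_nonneg ϑ f s e)).trans (hlow s hs e))
      (hup s hs)
  refine ⟨fun s => ∑' e, z s e, fun s hs => hasTrace_zetaOperator (by linarith) (hz s hs), ?_⟩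
  have hlim := tendsto_sub_one_mul_tsum hf
  have hfac : ∀ k : ℝ, 0 < k →
      Tendsto (fun s : ℝ => k ^ (s - 1) * ((s - 1) * A s)) (𝓝[>] 1) (𝓝 (l / Real.log 3)) :=
    fun k hk => by
      have hc : Continuous fun s : ℝ => k ^ (s - 1) :=
        Real.continuous_const_rpow hk.ne' |>.comp (continuous_id.sub continuous_const)
      have h1 := (hc.tendsto 1).mono_left (nhdsWithin_le_nhds (s := Set.Ioi (1 : ℝ)))
      rw [sub_self, Real.rpow_zero] at h1
      have h2 := h1.mul hlim
      rw [one_mul] at h2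
      exact h2
  refine tendsto_of_tendsto_of_tendsto_of_le_of_le' (hfac m hm0) (hfac 2 two_pos) ?_ ?_
  · filter_upwards [self_mem_nhdsWithin] with s hs
    have h1 := hasSum_le (hlow s hs) ((hA s hs).mul_left _) (hz s hs).hasSum
    have h2 : 0 ≤ s - 1 := by have : (1 : ℝ) < s := hs; linarith
    rw [mul_left_comm]
    exact mul_le_mul_of_nonneg_left h1 h2
  · filter_upwards [self_mem_nhdsWithin] with s hs
    have h1 := hasSum_le (hup s hs) (hz s hs).hasSum ((hA s hs).mul_left _)
    have h2 : 0 ≤ s - 1 := by have : (1 : ℝ) < s := hs; linarith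
    rw [mul_left_comm]
    exact mul_le_mul_of_nonneg_left h1 h2

theorem limitEnergy_comp_deform (ϑ : ℝ) (c : Fin 4 → Fin 4 → ℝ) (ρ : ℝ) (f : Plane → ℂ) :
    limitEnergy (Real.pi / 4) c ρ (f ∘ deform ϑ) = limitEnergy ϑ c ρ f := by
  simp only [limitEnergy, formSum_comp_deform]

end RhombicVicsek

end

open RhombicVicsek in
theorem theorem3p3 :
    (∀ ϑ ∈ Set.Ioo (0 : ℝ) (Real.pi / 2),
      deform ϑ '' fractal (Real.pi / 4) = fractal ϑ ∧
      IsEigenform (Real.pi / 4) (vicsekConductance (paramH ϑ)) (1 / 3) ∧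
      (∀ g : Plane → ℂ, ContinuousOn g (fractal (Real.pi / 4)) →
        Tendsto
          (fun n : ℕ => ENNReal.ofReal
            (((1 / 3 : ℝ) ^ n)⁻¹ *
              formSum (Real.pi / 4) (vicsekConductance (paramH ϑ)) n g))
          atTop
          (𝓝 (limitEnergy (Real.pi / 4) (vicsekConductance (paramH ϑ)) (1 / 3) g))) ∧
      ∃ c : ℝ, 0 < c ∧
        ∀ f : Plane → ℂ, ContinuousOn f (fractal ϑ) →
          limitEnergy (Real.pi / 4) (vicsekConductance (paramH ϑ)) (1 / 3) (f ∘ deform ϑ) < ⊤ →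
          ∃ Z : ℝ → ℝ,
            (∀ s : ℝ, 1 < s → HasTrace (zetaOperator ϑ f s) (Z s)) ∧
            Tendsto (fun s : ℝ => (s - 1) * Z s) (𝓝[>] 1)
              (𝓝 (c * (limitEnergy (Real.pi / 4) (vicsekConductance (paramH ϑ)) (1 / 3)
                (f ∘ deform ϑ)).toReal))) ∧
    ∀ H : ℝ, 0 < H → ∃! ϑ : ℝ, ϑ ∈ Set.Ioo (0 : ℝ) (Real.pi / 2) ∧ paramH ϑ = H := by
  refine ⟨fun ϑ h => ⟨deform_image_fractal ϑ, isEigenform_vicsek (paramH_pos h),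
    fun g _ => tendsto_limitEnergy (paramH_pos h) _ g, ?_⟩, fun H hH => existsUnique_paramH hH⟩
  obtain ⟨hs, hc⟩ := sin_pos_cos_pos h
  have hlog : 0 < Real.log 3 := Real.log_pos (by norm_num)
  -- The constant is $\kappa/\log 3$, with $\kappa$ from `form_lengthConductance`.
  refine ⟨(2 + (Real.cos ϑ)⁻¹) * (2 + (Real.sin ϑ)⁻¹) /
      (2 * (4 + (Real.cos ϑ)⁻¹ + (Real.sin ϑ)⁻¹)) / Real.log 3, by positivity, fun f _ hf => ?_⟩
  rw [limitEnergy_comp_deform] at hf ⊢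
  rw [div_mul_eq_mul_div]
  exact exists_zeta h (tendsto_scaledSum_lengthConductance h rfl hf)
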